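/- An instance $I$ of \textsc{Envy-Free Allocation Extension} consists of a set $N$ of $n$ agents, a set $M$ of $m$ indivisible items, for each agent $i$ an additive valuation given by values $v_i(a)\in\mathbb{N}$ for $a\in M$ (written in binary), and a partial allocation $\gamma:M'\to N$ of a subset $M'\subseteq M$ of given items. The question is whether there is an allocation $\pi:M\setminus M'\to N$ of the open items such that $\gamma\cup\pi$ is envy-free, i.e. $v_i(\gamma^{-1}(i)\cup\pi^{-1}(i))\ge v_i(\gamma^{-1}(j)\cup\pi^{-1}(j))$ for all agents $i,j$, where $v_i(B)=\sum_{a\in B}v_i(a)$. Let $k=|M\setminus M'|$ be the number of open items and let $n_t$ be the number of agent types, where two agents are of the same type if they have the same valuation function. Theorem. \textsc{Envy-Free Allocation Extension} is fixed-parameter tractable when parameterized by $k+n_t$: there are an algorithm, a computable function $f$ and a constant $c$ such that the algorithm decides every instance $I$ in time $f(k+n_t)\cdot \|I\|^{c}$, where $\|I\|$ is the length of $I$ in binary. More precisely, the problem can be solved by an algorithm which, on a random access machine that charges one step for each addition, subtraction, comparison and memory access, takes time $$(k\cdot n_t)^{\mathcal{O}(k)}\cdot n^2+\mathcal{O}(|I|),$$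 where $|I|=2+m+n\cdot m$ is the number of integers in the input; that is, for some constant $C$ it takes at most $C\cdot\bigl((k\,n_t)^{Ck}\,n^2+|I|\bigr)$ steps on every instance (with $0^0=1$). -/

import Mathlib

/-! ## Random access machines with a step count -/

namespace RAM

/-- A memory configuration: registers, and arrays of natural numbers, indexed by natural numbers.
A program mentions only finitely many registers and finitely many arrays. -/
structure State where
  reg : ℕ → ℕ
  arr : ℕ → ℕ → ℕ

/-- Expressions: constants, registers, array cells (with a computed address), addition, truncated
subtraction and comparisons (with value `1` or `0`). There is no multiplication, so that
counting one step per operation is polynomially equivalent to the time of a Turing machine. -/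
inductive Expr where
  | const (c : ℕ)
  | reg (r : ℕ)
  | read (a : ℕ) (i : Expr)
  | add (e₁ e₂ : Expr)
  | sub (e₁ e₂ : Expr)
  | lt (e₁ e₂ : Expr)
  | eq (e₁ e₂ : Expr)

/-- The value of an expression. -/
def Expr.eval (s : State) : Expr → ℕ
  | const c => c
  | reg r => s.reg r
  | read a i => s.arr a (i.eval s)
  | add e₁ e₂ => e₁.eval s + e₂.eval s
  | sub e₁ e₂ => e₁.eval s - e₂.eval s
  | lt e₁ e₂ => if e₁.eval s < e₂.eval s then 1 else 0
  | eq e₁ e₂ => if e₁.eval s = e₂.eval s then 1 else 0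

/-- The number of steps needed to evaluate an expression: one for each node. -/
def Expr.cost : Expr → ℕ
  | const _ => 1
  | reg _ => 1
  | read _ i => i.cost + 1
  | add e₁ e₂ => e₁.cost + e₂.cost + 1
  | sub e₁ e₂ => e₁.cost + e₂.cost + 1
  | lt e₁ e₂ => e₁.cost + e₂.cost + 1
  | eq e₁ e₂ => e₁.cost + e₂.cost + 1

/-- Programs: `assign r e` stores the value of `e` in register `r`; `store a i e` stores the value of
`e` in the cell of array `a` whose address is the value of `i`; a test succeeds if the value of
its expression is not `0`; `loop b p` repeats `p` as long as the test `b` succeeds. -/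
inductive Prog where
  | nop
  | assign (r : ℕ) (e : Expr)
  | store (a : ℕ) (i e : Expr)
  | seq (p q : Prog)
  | ite (b : Expr) (p q : Prog)
  | loop (b : Expr) (p : Prog)

/-- The configuration after storing `v` in register `r`. -/
def State.setReg (s : State) (r v : ℕ) : State :=
  { s with reg := Function.update s.reg r v }

/-- The configuration after storing `v` in the cell `i` of array `a`. -/
def State.setArr (s : State) (a i v : ℕ) : State :=
  { s with arr := Function.update s.arr a (Function.update (s.arr a) i v) }

/-- `Exec p s t s'`: started in the configuration `s`, the program `p` halts after exactly `t`
steps, in the configuration `s'`. -/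
inductive Exec : Prog → State → ℕ → State → Prop where
  | nop (s : State) : Exec .nop s 1 s
  | assign (s : State) (r : ℕ) (e : Expr) :
      Exec (.assign r e) s (e.cost + 1) (s.setReg r (e.eval s))
  | store (s : State) (a : ℕ) (i e : Expr) :
      Exec (.store a i e) s (i.cost + e.cost + 1) (s.setArr a (i.eval s) (e.eval s))
  | seq {p q : Prog} {s₁ s₂ s₃ : State} {t₁ t₂ : ℕ}
      (hp : Exec p s₁ t₁ s₂) (hq : Exec q s₂ t₂ s₃) : Exec (.seq p q) s₁ (t₁ + t₂) s₃
  | ite_true {b : Expr} {p q : Prog} {s s' : State} {t : ℕ}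
      (hb : b.eval s ≠ 0) (hp : Exec p s t s') : Exec (.ite b p q) s (b.cost + 1 + t) s'
  | ite_false {b : Expr} {p q : Prog} {s s' : State} {t : ℕ}
      (hb : b.eval s = 0) (hq : Exec q s t s') : Exec (.ite b p q) s (b.cost + 1 + t) s'
  | loop_true {b : Expr} {p : Prog} {s₁ s₂ s₃ : State} {t₁ t₂ : ℕ}
      (hb : b.eval s₁ ≠ 0) (hp : Exec p s₁ t₁ s₂) (hw : Exec (.loop b p) s₂ t₂ s₃) :
      Exec (.loop b p) s₁ (b.cost + 1 + t₁ + t₂) s₃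
  | loop_false {b : Expr} {p : Prog} {s : State}
      (hb : b.eval s = 0) : Exec (.loop b p) s (b.cost + 1) s

/-- The initial configuration on a list of numbers: register `0` holds its length, array `0` its
entries, and everything else is `0`. -/
def State.init (w : List ℕ) : State where
  reg := fun r => if r = 0 then w.length else 0
  arr := fun a i => if a = 0 then w.getD i 0 else 0

/-- On the input `w`, the program `p` halts within `T` steps, and the final content of register `0`
is `1` if the answer `Q` is yes, and `0` if it is no. -/
def DecidesWithin (p : Prog) (w : List ℕ) (Q : Prop) (T : ℕ) : Prop :=
  ∃ t s', Exec p (State.init w) t s' ∧ t ≤ T ∧ (Q → s'.reg 0 = 1) ∧ (¬ Q → s'.reg 0 = 0)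

/-- The size of a list of numbers, written in binary with one separator for each entry. -/
def bitSize (w : List ℕ) : ℕ :=
  (w.map fun x => Nat.size x + 1).sum

/-- Fixed-parameter tractability of the decision problem `Q` on instances of type `α`, encoded by
`enc`, with parameter `κ`: some program decides every instance `x` in time
`f (κ x) * |x| ^ c`, for a computable function `f` and a constant `c`. -/
def FixedParameterTractable {α : Type} (enc : α → List ℕ) (κ : α → ℕ) (Q : α → Prop) : Prop :=
  ∃ (p : Prog) (f : ℕ → ℕ) (c : ℕ), Computable f ∧
    ∀ x : α, DecidesWithin p (enc x) (Q x) (f (κ x) * bitSize (enc x) ^ c)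

end RAM

/-! ## Envy-Free Allocation Extension -/

/-- An instance: `n` agents with additive valuations of `m` items, and a partial allocation, which
maps each given item to its owner, and each open item to `none`. -/
structure AllocationInstance where
  n : ℕ
  m : ℕ
  val : Fin n → Fin m → ℕ
  given : Fin m → Option (Fin n)

namespace AllocationInstance

variable (I : AllocationInstance)

/-- The open items. -/
abbrev OpenItem : Type := {a : Fin I.m // I.given a = none}

/-- The number `k` of open items. -/
def numOpen : ℕ := Fintype.card I.OpenItem

/-- The number `n_t` of agent types: two agents have the same type if they have the same
valuation. -/
def numAgentTypes : ℕ := (Finset.univ.image I.val).card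

/-- The value of a bundle for agent `i`. -/
def value (i : Fin I.n) (B : Finset (Fin I.m)) : ℕ := ∑ a ∈ B, I.val i a

/-- The bundle of given items of agent `i`. -/
def givenBundle (i : Fin I.n) : Finset (Fin I.m) :=
  Finset.univ.filter fun a => I.given a = some i

/-- The bundle of open items that agent `i` receives from an allocation `π` of the open items. -/
def openBundle (π : I.OpenItem → Fin I.n) (i : Fin I.n) : Finset (Fin I.m) :=
  (Finset.univ.filter fun a : I.OpenItem => π a = i).image Subtype.val

/-- The bundle of agent `i` in the extended allocation. -/
def bundle (π : I.OpenItem → Fin I.n) (i : Fin I.n) : Finset (Fin I.m) :=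
  I.givenBundle i ∪ I.openBundle π i

/-- The extended allocation is envy-free. -/
def EnvyFree (π : I.OpenItem → Fin I.n) : Prop :=
  ∀ i j : Fin I.n, I.value i (I.bundle π j) ≤ I.value i (I.bundle π i)

/-- The question: is there an allocation of the open items such that the extended allocation is
envy-free? -/
def HasEnvyFreeExtension : Prop := ∃ π : I.OpenItem → Fin I.n, I.EnvyFree π

/-- The encoding of an instance: the number of agents, the number of items, for each item its owner
(`j + 1` for agent `j`, and `0` for an open item), and the valuations, agent by agent. -/
def encode : List ℕ :=
  [I.n, I.m] ++ List.ofFn (fun a => (I.given a).elim 0 fun j => j.val + 1) ++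
    (List.ofFn fun i => List.ofFn (I.val i)).flatten

end AllocationInstance

/-! Let `W` be the values of the given bundles and `U` those of the open items. Two observations
bound the agents that matter for items of positive value to their owner. An agent who envies
somebody for the given items must receive an open item, so an instance with more than `k` such
agents is a no-instance (`NoEnvy.count_envious_le`). If `i` receives an item `a` with `U i a > 0`,
then every agent who values `a` and, for the given items, does not prefer her own bundle to that of
`i` must receive an open item too, so there are at most `k` of these; an agent with such an item is
special (`NoEnvy.special`). Special agents of one type who are not envious are all counted among
each other's rivals, hence there are at most `k * n_t + k` special agents (`count_special_le`).

The other items are worthless to their owners. Group them by owner and let `X` be the bundle values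
without them. Owners lose nothing when their group is taken away, so a group may move to any agent
`i` whom nobody envies after adding it to `X`, provided that different groups go to different
agents. By Hall's theorem each group can be placed among its first `k` feasible agents
(`exists_injective_count_lt`).

So some envy-free allocation, if there is one, is described by `k` digits in base `S + 2 * k`, with
`S` the number of special agents: a digit names a special agent, or the rank of a feasible agent for
a group led by the item, or the leader of the item's group (`NoEnvy.exists_decodes`). The program
tries all `(S + 2 * k) ^ k` numbers and tests each resulting allocation in time polynomial in `k`
and quadratic in `n`. Since `S + 2 * k ≤ 4 * k * n_t` when there is an agent, this gives the time
bound. The time and correctness of the program are proved by a Hoare logic with step counts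
(`Runs`). -/

namespace RAM

/-! ### Time-bounded total correctness -/

@[simp] theorem State.setReg_reg (s : State) (r v q : ℕ) :
    (s.setReg r v).reg q = if q = r then v else s.reg q := by
  simp [State.setReg, Function.update_apply]

@[simp] theorem State.setReg_arr (s : State) (r v : ℕ) : (s.setReg r v).arr = s.arr := rfl

@[simp] theorem State.setArr_reg (s : State) (a i v : ℕ) : (s.setArr a i v).reg = s.reg := rfl

@[simp] theorem State.setArr_arr (s : State) (a i v b j : ℕ) :
    (s.setArr a i v).arr b j = if b = a ∧ j = i then v else s.arr b j := by
  by_cases hb : b = a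
  · subst hb; simp [State.setArr, Function.update_apply]
  · simp [State.setArr, hb]

/-- The registers that a program may write. -/
def Prog.wr : Prog → List ℕ
  | .nop => []
  | .assign r _ => [r]
  | .store _ _ _ => []
  | .seq p q => p.wr ++ q.wr
  | .ite _ p q => p.wr ++ q.wr
  | .loop _ p => p.wr

/-- The arrays that a program may write. -/
def Prog.wa : Prog → List ℕ
  | .nop => []
  | .assign _ _ => []
  | .store a _ _ => [a]
  | .seq p q => p.wa ++ q.wa
  | .ite _ p q => p.wa ++ q.wa
  | .loop _ p => p.wa

/-- Two configurations agree outside of the registers and arrays that `p` may write. -/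
structure Agree (p : Prog) (s s' : State) : Prop where
  reg : ∀ r, r ∉ p.wr → s'.reg r = s.reg r
  arr : ∀ a, a ∉ p.wa → s'.arr a = s.arr a

theorem Agree.refl (p : Prog) (s : State) : Agree p s s := ⟨fun _ _ => rfl, fun _ _ => rfl⟩

theorem Agree.trans {p : Prog} {s₁ s₂ s₃ : State} (h : Agree p s₁ s₂) (h' : Agree p s₂ s₃) :
    Agree p s₁ s₃ :=
  ⟨fun r hr => (h'.reg r hr).trans (h.reg r hr), fun a ha => (h'.arr a ha).trans (h.arr a ha)⟩

theorem Agree.mono {p q : Prog} {s s' : State} (h : Agree p s s') (hr : p.wr ⊆ q.wr)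
    (ha : p.wa ⊆ q.wa) : Agree q s s' :=
  ⟨fun r h' => h.reg r fun h'' => h' (hr h''), fun a h' => h.arr a fun h'' => h' (ha h'')⟩

/-- The frame rule. The written registers and arrays are lists computed from the syntax, so that
`decide` settles whether a value survives a concrete program. -/
theorem Exec.agree {p : Prog} {s s' : State} {t : ℕ} (h : Exec p s t s') : Agree p s s' := by
  induction h with
  | nop s => exact Agree.refl _ _
  | assign s r e =>
    exact ⟨fun q hq => by simp_all [Prog.wr], fun _ _ => rfl⟩
  | store s a i e =>
    refine ⟨fun _ _ => rfl, fun b hb => ?_⟩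
    have : b ≠ a := by simpa [Prog.wa] using hb
    simp [State.setArr, this]
  | seq _ _ h₁ h₂ =>
    exact (h₁.mono (by simp [Prog.wr]) (by simp [Prog.wa])).trans
      (h₂.mono (by simp [Prog.wr]) (by simp [Prog.wa]))
  | ite_true _ _ h => exact h.mono (by simp [Prog.wr]) (by simp [Prog.wa])
  | ite_false _ _ h => exact h.mono (by simp [Prog.wr]) (by simp [Prog.wa])
  | loop_true _ _ _ h₁ h₂ =>
    exact (h₁.mono (by simp [Prog.wr]) (by simp [Prog.wa])).trans h₂
  | loop_false _ => exact Agree.refl _ _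

/-- Started in `s`, the program `p` halts within `T` steps in a configuration satisfying `Q`. -/
def Runs (p : Prog) (s : State) (T : ℕ) (Q : State → Prop) : Prop :=
  ∃ t s', Exec p s t s' ∧ t ≤ T ∧ Q s'

theorem Runs.weaken {p : Prog} {s : State} {T T' : ℕ} {Q Q' : State → Prop} (h : Runs p s T Q)
    (hT : T ≤ T') (hQ : ∀ s', Agree p s s' → Q s' → Q' s') : Runs p s T' Q' := by
  obtain ⟨t, s', he, ht, hq⟩ := h
  exact ⟨t, s', he, ht.trans hT, hQ s' he.agree hq⟩

theorem Runs.mono {p : Prog} {s : State} {T T' : ℕ} {Q : State → Prop} (h : Runs p s T Q)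
    (hT : T ≤ T') : Runs p s T' Q := h.weaken hT fun _ _ h => h

theorem Runs.nop {s : State} {Q : State → Prop} (h : Q s) : Runs .nop s 1 Q :=
  ⟨1, s, .nop s, le_rfl, h⟩

theorem Runs.assign {s : State} {r : ℕ} {e : Expr} {Q : State → Prop}
    (h : Q (s.setReg r (e.eval s))) : Runs (.assign r e) s (e.cost + 1) Q :=
  ⟨_, _, .assign s r e, le_rfl, h⟩

theorem Runs.store {s : State} {a : ℕ} {i e : Expr} {Q : State → Prop}
    (h : Q (s.setArr a (i.eval s) (e.eval s))) : Runs (.store a i e) s (i.cost + e.cost + 1) Q :=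
  ⟨_, _, .store s a i e, le_rfl, h⟩

theorem Runs.seq {p q : Prog} {s : State} {T₁ T₂ : ℕ} {Q : State → Prop}
    (h : Runs p s T₁ fun s' => Runs q s' T₂ Q) : Runs (.seq p q) s (T₁ + T₂) Q := by
  obtain ⟨t, s', he, ht, t', s'', he', ht', hq⟩ := h
  exact ⟨_, _, .seq he he', add_le_add ht ht', hq⟩

/-- Adding the bounds of both branches instead of taking their maximum keeps all time bounds
polynomial expressions. -/
theorem Runs.ite {b : Expr} {p q : Prog} {s : State} {T₁ T₂ : ℕ} {Q : State → Prop}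
    (h₁ : b.eval s ≠ 0 → Runs p s T₁ Q) (h₂ : b.eval s = 0 → Runs q s T₂ Q) :
    Runs (.ite b p q) s (b.cost + 1 + (T₁ + T₂)) Q := by
  by_cases hb : b.eval s = 0
  · obtain ⟨t, s', he, ht, hq⟩ := h₂ hb
    exact ⟨_, _, .ite_false hb he, by omega, hq⟩
  · obtain ⟨t, s', he, ht, hq⟩ := h₁ hb
    exact ⟨_, _, .ite_true hb he, by omega, hq⟩

/-- The invariant is indexed by the number of completed rounds and decides the test, so there are
exactly `N` rounds; the induction is on the number of rounds left. -/
theorem Runs.loop {b : Expr} {p : Prog} {T : ℕ} (N : ℕ) (I : ℕ → State → Prop)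
    (hstep : ∀ i < N, ∀ s, I i s → b.eval s ≠ 0 ∧ Runs p s T (I (i + 1)))
    (hend : ∀ s, I N s → b.eval s = 0) {s : State} (h0 : I 0 s) :
    Runs (.loop b p) s (N * (b.cost + 1 + T) + (b.cost + 1)) (I N) := by
  have key : ∀ j i s, i + j = N → I i s →
      Runs (.loop b p) s (j * (b.cost + 1 + T) + (b.cost + 1)) (I N) := by
    intro j
    induction j with
    | zero =>
      intro i s hi hs
      obtain rfl : i = N := by simpa using hi
      exact ⟨_, _, .loop_false (hend s hs), by omega, hs⟩
    | succ j ih =>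
      intro i s hi hs
      obtain ⟨hb, t, s', he, ht, hs'⟩ := hstep i (by omega) s hs
      obtain ⟨t', s'', he', ht', hq⟩ := ih (i + 1) s' (by omega) hs'
      refine ⟨_, _, .loop_true hb he he', ?_, hq⟩
      rw [Nat.succ_mul]
      omega
  exact key N 0 s (by simp) h0

/-- `for r := 0` up to the content of register `b` (exclusive). -/
def forUp (r b : ℕ) (p : Prog) : Prog :=
  .seq (.assign r (.const 0))
    (.loop (.lt (.reg r) (.reg b)) (.seq p (.assign r (.add (.reg r) (.const 1)))))

/-- The step may use agreement with the state before the loop, so an invariant need only mention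
what the body changes. The overhead of `8` in each round is `4` for the test and `4` for the
increment of the counter. -/
theorem Runs.forUp {r b : ℕ} {p : Prog} {s : State} {T N : ℕ} (I : ℕ → State → Prop)
    (hN : s.reg b = N) (hr : r ∉ p.wr) (hb : b ∉ p.wr) (hrb : r ≠ b)
    (h0 : I 0 (s.setReg r 0))
    (hstep : ∀ i < N, ∀ s', s'.reg r = i → Agree (forUp r b p) s s' → I i s' →
      Runs p s' T fun s'' => I (i + 1) (s''.setReg r (i + 1))) :
    Runs (forUp r b p) s (N * (T + 8) + 6) (I N) := by
  refine (Runs.seq (T₁ := 2) (T₂ := N * (T + 8) + 4) ?_).mono (by omega)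
  refine Runs.assign ?_
  have hT : N * (T + 8) + 4 = N * ((Expr.lt (.reg r) (.reg b)).cost + 1 + (T + 4)) +
      ((Expr.lt (.reg r) (.reg b)).cost + 1) := by simp only [Expr.cost]; ring
  rw [hT]
  refine (Runs.loop N (fun i s' => s'.reg r = i ∧ Agree (RAM.forUp r b p) s s' ∧ I i s') ?_ ?_
    ?_).weaken le_rfl fun s' _ h => h.2.2
  · rintro i hi s₁ ⟨h1, h2, h3⟩
    have hb' : s₁.reg b = N := by
      rw [h2.reg b ?_, hN]
      simp [RAM.forUp, Prog.wr, hb, Ne.symm hrb]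
    refine ⟨by simp [Expr.eval, h1, hb', hi], ?_⟩
    refine Runs.seq (T₂ := 4) ((hstep i hi s₁ h1 h2 h3).weaken le_rfl fun s₂ h4 h5 => ?_)
    refine Runs.assign ?_
    have hr2 : s₂.reg r = i := by rw [h4.reg r hr, h1]
    refine ⟨by simp [Expr.eval, hr2], h2.trans ?_, by simpa [Expr.eval, hr2] using h5⟩
    have h6 : Agree (RAM.forUp r b p) s₁ s₂ :=
      h4.mono (by simp [RAM.forUp, Prog.wr]) (by simp [RAM.forUp, Prog.wa])
    refine h6.trans ⟨fun q hq => ?_, fun _ _ => rfl⟩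
    have : q ≠ r := by rintro rfl; simp [RAM.forUp, Prog.wr] at hq
    simp [this]
  · rintro s₁ ⟨h1, h2, _⟩
    have hb' : s₁.reg b = N := by
      rw [h2.reg b ?_, hN]
      simp [RAM.forUp, Prog.wr, hb, Ne.symm hrb]
    simp [Expr.eval, h1, hb']
  · refine ⟨by simp [Expr.eval], ⟨fun q hq => ?_, fun _ _ => rfl⟩, by simpa [Expr.eval] using h0⟩
    have : q ≠ r := by rintro rfl; simp [RAM.forUp, Prog.wr] at hq
    simp [this]

end RAM

/-! ### Bundle values of an allocation of the open items -/

namespace EnvySearch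

open RAM Finset

theorem mul_add_inj {n i j i' j' : ℕ} (hj : j < n) (hj' : j' < n) :
    i * n + j = i' * n + j' ↔ i = i' ∧ j = j' := by
  refine ⟨fun h => ?_, fun ⟨h, h'⟩ => by rw [h, h']⟩
  have hn : 0 < n := by omega
  have h1 := congrArg (· / n) h
  have h2 := congrArg (· % n) h
  simp only [Nat.mul_comm _ n, Nat.mul_add_div hn, Nat.mul_add_mod,
    Nat.div_eq_of_lt hj, Nat.div_eq_of_lt hj', Nat.mod_eq_of_lt hj, Nat.mod_eq_of_lt hj'] at h1 h2
  exact ⟨by simpa using h1, h2⟩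

/-- The value for agent `i` of the bundle of agent `j`, when `W` gives the values of the given
bundles, `U i a` is the value for `i` of the open item `a < k`, and `f a` is `0` if the open item `a`
is not allocated, and `j + 1` if it is allocated to agent `j`. -/
def extend (W U : ℕ → ℕ → ℕ) (k : ℕ) (f : ℕ → ℕ) (i j : ℕ) : ℕ :=
  W i j + ∑ a ∈ range k, if f a = j + 1 then U i a else 0

/-- Registers `1`, `3` hold `n` and `k`; array `4` the multiples of `n`; arrays `1`, `2` the values
of the given bundles and of the open items. -/
structure Env (n k : ℕ) (W U : ℕ → ℕ → ℕ) (s : State) : Prop where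
  n_eq : s.reg 1 = n
  k_eq : s.reg 3 = k
  row : ∀ i < n + k, s.arr 4 i = i * n
  W_eq : ∀ i < n, ∀ j < n, s.arr 1 (i * n + j) = W i j
  U_eq : ∀ a < k, ∀ i < n, s.arr 2 (a * n + i) = U i a

variable {n k : ℕ} {W U : ℕ → ℕ → ℕ} {s s' : State} {p : Prog}

theorem Env.congr (h : Env n k W U s) (h1 : s'.reg 1 = s.reg 1) (h3 : s'.reg 3 = s.reg 3)
    (a1 : s'.arr 1 = s.arr 1) (a2 : s'.arr 2 = s.arr 2) (a4 : s'.arr 4 = s.arr 4) :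
    Env n k W U s' :=
  ⟨h1.trans h.n_eq, h3.trans h.k_eq, by rw [a4]; exact h.row, by rw [a1]; exact h.W_eq,
    by rw [a2]; exact h.U_eq⟩

theorem Env.agree (h : Env n k W U s) (ha : Agree p s s')
    (hp : (1 ∉ p.wr ∧ 3 ∉ p.wr) ∧ 1 ∉ p.wa ∧ 2 ∉ p.wa ∧ 4 ∉ p.wa) : Env n k W U s' :=
  h.congr (ha.reg _ hp.1.1) (ha.reg _ hp.1.2) (ha.arr _ hp.2.1) (ha.arr _ hp.2.2.1)
    (ha.arr _ hp.2.2.2)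

/-- The address of the entry `(i, j)` of a matrix with rows of length `n`, where `i` and `j` are the
contents of registers. -/
abbrev addr (r q : ℕ) : Expr := .add (.read 4 (.reg r)) (.reg q)

/-- Compute in array `3` the values of all bundles, when the open items are allocated according to
array `5`. -/
def build : Prog :=
  .seq (forUp 10 1 (forUp 11 1 (.store 3 (addr 10 11) (.read 1 (addr 10 11)))))
    (forUp 10 3 (.ite (.read 5 (.reg 10))
      (forUp 11 1 (.store 3 (.add (.read 4 (.reg 11)) (.sub (.read 5 (.reg 10)) (.const 1)))
        (.add (.read 3 (.add (.read 4 (.reg 11)) (.sub (.read 5 (.reg 10)) (.const 1))))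
          (.read 2 (addr 10 11)))))
      .nop))

theorem runs_build (hs : Env n k W U s) (h5 : ∀ a < k, s.arr 5 a ≤ n) :
    Runs build s (n * (n * 20 + 20) + k * (n * 40 + 30) + 20) fun s' =>
      ∀ i < n, ∀ j < n, s'.arr 3 (i * n + j) = extend W U k (s.arr 5) i j := by
  have hcopy : Runs (forUp 10 1 (forUp 11 1 (.store 3 (addr 10 11) (.read 1 (addr 10 11))))) s
      (n * (n * (10 + 8) + 6 + 8) + 6) fun s' =>
        ∀ i < n, ∀ j < n, s'.arr 3 (i * n + j) = W i j := by
    refine Runs.forUp (fun i s' => ∀ i' < i, ∀ j < n, s'.arr 3 (i' * n + j) = W i' j) hs.n_eq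
      (by decide) (by decide) (by decide) (by simp) fun i hi s₁ hr₁ ha₁ hI₁ => ?_
    have hs₁ := hs.agree ha₁ (by decide)
    refine (Runs.forUp (fun j s' => (∀ i' < i, ∀ j < n, s'.arr 3 (i' * n + j) = W i' j) ∧
      ∀ j' < j, s'.arr 3 (i * n + j') = W i j') hs₁.n_eq
      (by decide) (by decide) (by decide) (by simpa using hI₁)
      fun j hj s₂ hr₂ ha₂ hI₂ => ?_).weaken le_rfl fun s₂ _ h => ?_
    · have hs₂ := hs₁.agree ha₂ (by decide)
      have hr₃ : s₂.reg 10 = i := by rw [ha₂.reg _ (by decide), hr₁]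
      refine (Runs.store ?_).mono (by simp [Expr.cost])
      have hrow := hs₂.row i (by omega)
      refine ⟨fun i' hi' j' hj' => ?_, fun j' hj' => ?_⟩
      · simp only [State.setReg_arr, State.setArr_arr, Expr.eval, hr₂, hr₃, hrow,
          mul_add_inj hj' hj, true_and]
        rw [if_neg (by omega), hI₂.1 i' hi' j' hj']
      · simp only [State.setReg_arr, State.setArr_arr, Expr.eval, hr₂, hr₃, hrow,
          hs₂.W_eq i hi j hj, true_and, Nat.add_left_cancel_iff]
        split_ifs with h
        · obtain rfl : j' = j := by omega
          rfl
        · exact hI₂.2 j' (by omega)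
    · intro i' hi' j hj
      simp only [State.setReg_arr]
      rcases Nat.lt_succ_iff_lt_or_eq.mp hi' with h' | rfl
      · exact h.1 i' h' j hj
      · exact h.2 j hj
  refine (Runs.seq (hcopy.weaken le_rfl fun s₁ ha₁ hW₁ => ?_)).mono
    (T := _ + (k * ((n * (24 + 8) + 6 + 10) + 8) + 6)) (by nlinarith)
  have hs₁ := hs.agree ha₁ (by decide)
  have h51 : s₁.arr 5 = s.arr 5 := ha₁.arr _ (by decide)
  refine Runs.forUp (fun a s' => ∀ i < n, ∀ j < n,
    s'.arr 3 (i * n + j) = extend W U a (s.arr 5) i j) hs₁.k_eq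
    (by decide) (by decide) (by decide) (by simpa [extend] using hW₁) fun a hak s₂ hr₂ ha₂ hI₂ => ?_
  have hs₂ := hs₁.agree ha₂ (by decide)
  have h52 : s₂.arr 5 = s.arr 5 := (ha₂.arr _ (by decide)).trans h51
  refine (Runs.ite (T₁ := n * (24 + 8) + 6) (T₂ := 1) (fun hb => ?_) (fun hb => Runs.nop ?_)).mono
    (by simp [Expr.cost]; omega)
  · have hb' : s.arr 5 a ≠ 0 := by simpa [Expr.eval, hr₂, h52] using hb
    refine (Runs.forUp (fun i s' => ∀ i' < n, ∀ j < n, s'.arr 3 (i' * n + j) =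
      extend W U a (s.arr 5) i' j + if i' < i ∧ s.arr 5 a = j + 1 then U i' a else 0) hs₂.n_eq
      (by decide) (by decide) (by decide) (by simpa using hI₂)
      fun i hi s₃ hr₃ ha₃ hI₃ => ?_).weaken le_rfl fun s₃ _ h => ?_
    · have hs₃ := hs₂.agree ha₃ (by decide)
      have hr₄ : s₃.reg 10 = a := by rw [ha₃.reg _ (by decide), hr₂]
      have h53 : s₃.arr 5 = s.arr 5 := (ha₃.arr _ (by decide)).trans h52
      have hrow := hs₃.row i (by omega)
      have hrowa := hs₃.row a (by omega)
      have h5a := h5 a hak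
      refine (Runs.store ?_).mono (by simp [Expr.cost])
      intro i' hi' j hj
      have hj' : s.arr 5 a - 1 < n := by omega
      simp only [State.setReg_arr, State.setArr_arr, Expr.eval, hr₃, hr₄, hrow, hrowa, h53,
        hs₃.U_eq a hak i hi, mul_add_inj hj hj', hI₃ i' hi' j hj, hI₃ i hi _ hj', true_and]
      by_cases h1 : i' = i
      · subst h1
        by_cases h2 : s.arr 5 a = j + 1
        · simp [h2]
        · rw [if_neg (by omega)]; simp [h2]
      · rw [if_neg (by omega)]
        have : i' < i + 1 ↔ i' < i := by omega
        simp [this]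
    · intro i hi j hj
      simp only [State.setReg_arr, h i hi j hj, hi, true_and]
      simp [extend, sum_range_succ, add_assoc]
  · have hb' : s.arr 5 a = 0 := by simpa [Expr.eval, hr₂, h52] using hb
    intro i hi j hj
    simp [hI₂ i hi j hj, extend, sum_range_succ, hb']

end EnvySearch

/-! ### Testing envy-freeness, and finding the envious and the special agents -/

namespace EnvySearch

open RAM Finset

variable {n k : ℕ} {W U X : ℕ → ℕ → ℕ} {s s' : State} {p : Prog}

/-- The number `v` is the truth value of `P`. -/
def Flag (v : ℕ) (P : Prop) : Prop := (P → v = 1) ∧ (¬ P → v = 0)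

theorem Flag.congr {v : ℕ} {P Q : Prop} (h : Flag v P) (hPQ : P ↔ Q) : Flag v Q := by
  rwa [← hPQ]

/-- Test whether the bundle values in array `3` are envy-free, with the answer in register `23`. -/
def check : Prog :=
  .seq (.assign 23 (.const 1))
    (forUp 10 1 (forUp 11 1 (.ite (.lt (.read 3 (addr 10 10)) (.read 3 (addr 10 11)))
      (.assign 23 (.const 0)) .nop)))

theorem runs_check (hs : Env n k W U s) (hX : ∀ i < n, ∀ j < n, s.arr 3 (i * n + j) = X i j) :
    Runs check s (n * (n * 30 + 20) + 20) fun s' =>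
      Flag (s'.reg 23) (∀ i < n, ∀ j < n, X i j ≤ X i i) := by
  refine (Runs.seq (T₂ := n * ((n * (20 + 8) + 6) + 8) + 6) (Runs.assign ?_)).mono
    (by simp [Expr.cost]; nlinarith)
  have hs₀ : Env n k W U (s.setReg 23 ((Expr.const 1).eval s)) := hs.congr rfl rfl rfl rfl rfl
  refine Runs.forUp (fun i s' => Flag (s'.reg 23) (∀ i' < i, ∀ j < n, X i' j ≤ X i' i')) hs₀.n_eq
    (by decide) (by decide) (by decide) (by simp [Flag, Expr.eval]) fun i hi s₁ hr₁ ha₁ hI₁ => ?_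
  have hs₁ := hs₀.agree ha₁ (by decide)
  have h3 : s₁.arr 3 = s.arr 3 := ha₁.arr _ (by decide)
  refine (Runs.forUp (fun j s' => Flag (s'.reg 23) ((∀ i' < i, ∀ j < n, X i' j ≤ X i' i') ∧
      ∀ j' < j, X i j' ≤ X i i)) hs₁.n_eq
    (by decide) (by decide) (by decide) (by simpa using hI₁)
    fun j hj s₂ hr₂ ha₂ hI₂ => ?_).weaken le_rfl fun s₂ _ h => ?_
  · have hs₂ := hs₁.agree ha₂ (by decide)
    have h3' : s₂.arr 3 = s.arr 3 := (ha₂.arr _ (by decide)).trans h3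
    have hr₃ : s₂.reg 10 = i := by rw [ha₂.reg _ (by decide), hr₁]
    have hb : (Expr.lt (.read 3 (addr 10 10)) (.read 3 (addr 10 11))).eval s₂ =
        if X i i < X i j then 1 else 0 := by
      simp [Expr.eval, hr₂, hr₃, hs₂.row i (by omega), h3', hX i hi j hj, hX i hi i hi]
    refine (Runs.ite (T₁ := 2) (T₂ := 1) (fun h => ?_) (fun h => ?_)).mono (by simp [Expr.cost])
    · have hlt : X i i < X i j := by
        by_contra hlt; simp [hb, hlt] at h
      refine Runs.assign ⟨fun h' => absurd (h'.2 j (by omega)) (by omega), fun _ => by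
        simp [Expr.eval]⟩
    · have hle : X i j ≤ X i i := by
        by_contra hlt; simp [hb] at h; omega
      refine Runs.nop ?_
      simp only [State.setReg_reg, if_neg (show (23 : ℕ) ≠ 11 by decide)]
      refine hI₂.congr (and_congr_right fun _ => ⟨fun h' j' hj' => ?_, fun h' j' hj' =>
        h' j' (by omega)⟩)
      rcases Nat.lt_succ_iff_lt_or_eq.mp hj' with h'' | rfl
      exacts [h' j' h'', hle]
  · simp only [State.setReg_reg, if_neg (show (23 : ℕ) ≠ 10 by decide)]
    refine h.congr ⟨fun h' i' hi' => ?_, fun h' => ⟨fun i' hi' => h' i' (by omega),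
      h' i (by omega)⟩⟩
    rcases Nat.lt_succ_iff_lt_or_eq.mp hi' with h'' | rfl
    exacts [h'.1 i' h'', h'.2]

/-- Agent `i` envies some agent for the given items. -/
abbrev Envious (n : ℕ) (W : ℕ → ℕ → ℕ) (i : ℕ) : Prop := ∃ j, j < n ∧ W i i < W i j

/-- Count in register `8` the envious agents. -/
def countEnvious : Prog :=
  .seq (.assign 8 (.const 0))
    (forUp 10 1 (.seq (.assign 23 (.const 0))
      (.seq (forUp 11 1 (.ite (.lt (.read 1 (addr 10 10)) (.read 1 (addr 10 11)))
        (.assign 23 (.const 1)) .nop))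
      (.assign 8 (.add (.reg 8) (.reg 23))))))

theorem runs_countEnvious (hs : Env n k W U s) :
    Runs countEnvious s (n * (n * 30 + 30) + 20) fun s' =>
      s'.reg 8 = Nat.count (Envious n W) n := by
  refine (Runs.seq (T₂ := n * ((2 + (n * (20 + 8) + 6 + 4)) + 8) + 6) (Runs.assign ?_)).mono
    (by simp [Expr.cost]; nlinarith)
  have hs₀ : Env n k W U (s.setReg 8 ((Expr.const 0).eval s)) := hs.congr rfl rfl rfl rfl rfl
  refine Runs.forUp (fun i s' => s'.reg 8 = Nat.count (Envious n W) i) hs₀.n_eq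
    (by decide) (by decide) (by decide) (by simp [Expr.eval]) fun i hi s₁ hr₁ ha₁ hI₁ => ?_
  have hs₁ := hs₀.agree ha₁ (by decide)
  refine Runs.seq (Runs.assign ?_)
  set s₁' := s₁.setReg 23 ((Expr.const 0).eval s₁) with hs₁'
  have hs₂ : Env n k W U s₁' := hs₁.congr rfl rfl rfl rfl rfl
  refine Runs.seq ((Runs.forUp (fun j s' => Flag (s'.reg 23) (∃ j', j' < j ∧ W i i < W i j'))
    hs₂.n_eq (by decide) (by decide) (by decide) (by simp [Flag, s₁', Expr.eval])
    fun j hj s₃ hr₃ ha₃ hI₃ => ?_).weaken le_rfl fun s₄ ha₄ h => ?_)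
  · have hs₃ := hs₂.agree ha₃ (by decide)
    have hr₄ : s₃.reg 10 = i := by rw [ha₃.reg _ (by decide), ← hr₁]; rfl
    have hb : (Expr.lt (.read 1 (addr 10 10)) (.read 1 (addr 10 11))).eval s₃ =
        if W i i < W i j then 1 else 0 := by
      simp [Expr.eval, hr₃, hr₄, hs₃.row i (by omega), hs₃.W_eq i hi j hj, hs₃.W_eq i hi i hi]
    refine (Runs.ite (T₁ := 2) (T₂ := 1) (fun h => ?_) (fun h => ?_)).mono (by simp [Expr.cost])
    · have hlt : W i i < W i j := by
        by_contra hlt; simp [hb, hlt] at h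
      exact Runs.assign ⟨fun _ => by simp [Expr.eval],
        fun h' => absurd ⟨j, by omega, hlt⟩ h'⟩
    · have hle : W i j ≤ W i i := by
        by_contra hlt; simp [hb] at h; omega
      refine Runs.nop ?_
      simp only [State.setReg_reg, if_neg (show (23 : ℕ) ≠ 11 by decide)]
      refine hI₃.congr ⟨fun ⟨j', hj', h⟩ => ⟨j', by omega, h⟩, fun ⟨j', hj', h⟩ => ⟨j', ?_, h⟩⟩
      rcases Nat.lt_succ_iff_lt_or_eq.mp hj' with h'' | rfl
      exacts [h'', absurd hle (by omega)]
  · have h8 : s₄.reg 8 = s₁.reg 8 := ha₄.reg _ (by decide)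
    refine (Runs.assign ?_).mono (by simp [Expr.cost])
    simp only [State.setReg_reg, Expr.eval, Nat.count_succ, h8, hI₁]
    by_cases hi' : Envious n W i
    · simp [h.1 hi', hi']
    · simp [h.2 hi', hi']

/-- The number of agents with a positive value for the open item `a` who, for the given items,
do not prefer their own bundle to that of `i`. -/
abbrev rivals (n : ℕ) (W U : ℕ → ℕ → ℕ) (i a : ℕ) : ℕ :=
  Nat.count (fun i' => W i' i' ≤ W i' i ∧ 0 < U i' a) n

/-- Agent `i` may receive an open item of positive value to her. -/
abbrev Special (n k : ℕ) (W U : ℕ → ℕ → ℕ) (i : ℕ) : Prop :=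
  ∃ a, a < k ∧ 0 < U i a ∧ rivals n W U i a ≤ k

/-- List in array `7` the special agents, with their number in register `4`. -/
def listSpecial : Prog :=
  .seq (.assign 4 (.const 0))
    (forUp 10 1 (.seq (.assign 23 (.const 0))
      (.seq (forUp 11 3 (.seq (.assign 24 (.const 0))
        (.seq (forUp 12 1 (.ite (.lt (.read 1 (addr 12 10)) (.read 1 (addr 12 12))) .nop
          (.ite (.read 2 (addr 11 12)) (.assign 24 (.add (.reg 24) (.const 1))) .nop)))
        (.ite (.read 2 (addr 11 10)) (.ite (.lt (.reg 3) (.reg 24)) .nop (.assign 23 (.const 1)))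
          .nop))))
      (.ite (.reg 23) (.seq (.store 7 (.reg 4) (.reg 10)) (.assign 4 (.add (.reg 4) (.const 1))))
        .nop))))

/-- The array `A` lists the special agents. -/
structure IsSpecialList (n k : ℕ) (W U : ℕ → ℕ → ℕ) (S : ℕ) (A : ℕ → ℕ) : Prop where
  card : S = Nat.count (Special n k W U) n
  lt : ∀ x < S, A x < n
  mem : ∀ i < n, Special n k W U i → ∃ x < S, A x = i

theorem runs_listSpecial (hs : Env n k W U s) :
    Runs listSpecial s (n * (k * (n * 40 + 40) + 40) + 20) fun s' =>
      IsSpecialList n k W U (s'.reg 4) (s'.arr 7) := by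
  refine (Runs.seq (T₂ := n * ((2 + ((k * ((2 + ((n * (30 + 8) + 6) + 18)) + 8) + 6) + 14)) + 8) + 6)
    (Runs.assign ?_)).mono (by simp [Expr.cost]; nlinarith [Nat.zero_le (n * k)])
  have hs₀ : Env n k W U (s.setReg 4 ((Expr.const 0).eval s)) := hs.congr rfl rfl rfl rfl rfl
  refine (Runs.forUp (fun i s' => s'.reg 4 = Nat.count (Special n k W U) i ∧
      (∀ x < s'.reg 4, s'.arr 7 x < n) ∧
      ∀ i' < i, Special n k W U i' → ∃ x < s'.reg 4, s'.arr 7 x = i') hs₀.n_eq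
    (by decide) (by decide) (by decide) (by simp [Expr.eval])
    fun i hi s₁ hr₁ ha₁ hI₁ => ?_).weaken le_rfl fun s' _ h => ⟨h.1, h.2.1, h.2.2⟩
  have hs₁ := hs₀.agree ha₁ (by decide)
  refine Runs.seq (Runs.assign ?_)
  set s₁' := s₁.setReg 23 ((Expr.const 0).eval s₁) with hs₁'
  have hs₂ : Env n k W U s₁' := hs₁.congr rfl rfl rfl rfl rfl
  refine Runs.seq ((Runs.forUp (fun a s' => Flag (s'.reg 23)
      (∃ a', a' < a ∧ 0 < U i a' ∧ rivals n W U i a' ≤ k))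
    hs₂.k_eq (by decide) (by decide) (by decide) (by simp [Flag, s₁', Expr.eval])
    fun a hak s₃ hr₃ ha₃ hI₃ => ?_).weaken le_rfl fun s₄ ha₄ h => ?_)
  · have hs₃ := hs₂.agree ha₃ (by decide)
    have hr₄ : s₃.reg 10 = i := by rw [ha₃.reg _ (by decide), ← hr₁]; rfl
    refine Runs.seq (Runs.assign ?_)
    set s₃' := s₃.setReg 24 ((Expr.const 0).eval s₃) with hs₃'
    have hs₄ : Env n k W U s₃' := hs₃.congr rfl rfl rfl rfl rfl
    have h11 : s₃'.reg 11 = a := hr₃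
    have h10 : s₃'.reg 10 = i := hr₄
    have h23 : s₃'.reg 23 = s₃.reg 23 := rfl
    refine Runs.seq ((Runs.forUp (fun i' s' => s'.reg 24 =
      Nat.count (fun i' => W i' i' ≤ W i' i ∧ 0 < U i' a) i') hs₄.n_eq (by decide) (by decide)
      (by decide) (by simp [s₃', Expr.eval]) fun i' hi' s₅ hr₅ ha₅ hI₅ => ?_).weaken le_rfl
      fun s₆ ha₆ h => ?_)
    · have hs₅ := hs₄.agree ha₅ (by decide)
      have g11 : s₅.reg 11 = a := (ha₅.reg _ (by decide)).trans h11
      have g10 : s₅.reg 10 = i := (ha₅.reg _ (by decide)).trans h10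
      have hb : (Expr.lt (.read 1 (addr 12 10)) (.read 1 (addr 12 12))).eval s₅ =
          if W i' i < W i' i' then 1 else 0 := by
        simp [Expr.eval, hr₅, g10, hs₅.row i' (by omega), hs₅.W_eq i' hi' i hi,
          hs₅.W_eq i' hi' i' hi']
      have hb' : (Expr.read 2 (addr 11 12)).eval s₅ = U i' a := by
        simp [Expr.eval, hr₅, g11, hs₅.row a (by omega), hs₅.U_eq a hak i' hi']
      refine (Runs.ite (T₁ := 1) (T₂ := 11) (fun h => ?_) (fun h => ?_)).mono (by simp [Expr.cost])
      · have : ¬ W i' i' ≤ W i' i := by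
          by_contra hlt; simp [hb] at h; omega
        exact Runs.nop (by simp [hI₅, Nat.count_succ, this])
      · have h1 : W i' i' ≤ W i' i := by
          by_contra hlt; simp [hb] at h; omega
        refine (Runs.ite (T₁ := 4) (T₂ := 1) (fun h => ?_) (fun h => ?_)).mono (by simp [Expr.cost])
        · rw [hb'] at h
          exact Runs.assign (by
            simp [hI₅, Nat.count_succ, h1, Nat.pos_of_ne_zero h, Expr.eval])
        · rw [hb'] at h
          exact Runs.nop (by simp [hI₅, Nat.count_succ, h])
    · have hs₆ := hs₄.agree ha₆ (by decide)
      have g11 : s₆.reg 11 = a := (ha₆.reg _ (by decide)).trans h11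
      have g10 : s₆.reg 10 = i := (ha₆.reg _ (by decide)).trans h10
      have g23 : s₆.reg 23 = s₃.reg 23 := (ha₆.reg _ (by decide)).trans h23
      have hb : (Expr.read 2 (addr 11 10)).eval s₆ = U i a := by
        simp [Expr.eval, g11, g10, hs₆.row a (by omega), hs₆.U_eq a hak i hi]
      -- Serves both branches in which the item `a` is no witness for `i` being special and the flag
      -- stays as it is.
      have hneg : ¬ (0 < U i a ∧ rivals n W U i a ≤ k) →
          Flag (s₆.reg 23) (∃ a', a' < a + 1 ∧ 0 < U i a' ∧ rivals n W U i a' ≤ k) := by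
        intro hn
        rw [g23]
        refine hI₃.congr ⟨fun ⟨a', ha', hp⟩ => ⟨a', by omega, hp⟩, fun ⟨a', ha', hp⟩ => ⟨a', ?_, hp⟩⟩
        rcases Nat.lt_succ_iff_lt_or_eq.mp ha' with h'' | rfl
        exacts [h'', absurd hp hn]
      refine (Runs.ite (T₁ := 7) (T₂ := 1) (fun h0 => ?_) (fun h0 => ?_)).mono (by simp [Expr.cost])
      · rw [hb] at h0
        have hb' : (Expr.lt (.reg 3) (.reg 24)).eval s₆ =
          if k < rivals n W U i a then 1 else 0 := by
          simp only [Expr.eval, hs₆.k_eq, h]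
        refine (Runs.ite (T₁ := 1) (T₂ := 2) (fun h => ?_) (fun h => ?_)).mono (by simp [Expr.cost])
        · refine Runs.nop ?_
          have : k < rivals n W U i a := by
            by_contra hlt; simp [hb', hlt] at h
          exact hneg fun h' => absurd h'.2 (by omega)
        · have : rivals n W U i a ≤ k := by
            by_contra hlt; simp [hb'] at h; omega
          exact Runs.assign ⟨fun _ => by simp [Expr.eval], fun h' =>
            absurd ⟨a, by omega, Nat.pos_of_ne_zero h0, this⟩ h'⟩
      · rw [hb] at h0
        exact Runs.nop (hneg fun h' => absurd h'.1 (by omega))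
  · have h10 : s₄.reg 10 = i := by rw [ha₄.reg _ (by decide), ← hr₁]; rfl
    have h4 : s₄.reg 4 = s₁.reg 4 := ha₄.reg _ (by decide)
    have h7 : s₄.arr 7 = s₁.arr 7 := ha₄.arr _ (by decide)
    obtain ⟨c1, c2, c3⟩ := hI₁
    refine (Runs.ite (T₁ := 7) (T₂ := 1) (fun h0 => ?_) (fun h0 => ?_)).mono
      (by simp [Expr.cost])
    · have hsp : Special n k W U i := by
        by_contra hn
        exact h0 (h.2 hn)
      refine (Runs.seq (Runs.store (Runs.assign ?_))).mono (by simp [Expr.cost])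
      refine ⟨by simp [Expr.eval, Nat.count_succ, h4, c1, hsp], fun x hx => ?_, fun i' hi' h' => ?_⟩
      · simp only [State.setReg_reg, State.setReg_arr, State.setArr_reg, State.setArr_arr, Expr.eval,
          true_and, h4, h7, h10] at hx ⊢
        split_ifs with hx'
        · exact hi
        · exact c2 x (by simp at hx; omega)
      · simp only [State.setReg_reg, State.setReg_arr, State.setArr_reg, State.setArr_arr, Expr.eval,
          true_and, h4, h7, h10]
        rcases Nat.lt_succ_iff_lt_or_eq.mp hi' with h'' | rfl
        · obtain ⟨x, hx, hx'⟩ := c3 i' h'' h'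
          exact ⟨x, by simp; omega, by rw [if_neg (by omega), hx']⟩
        · exact ⟨s₁.reg 4, by simp, by simp⟩
    · have hsp : ¬ Special n k W U i := by
        intro hn
        have h1 := h.1 hn
        simp [Expr.eval, h1] at h0
      refine Runs.nop ⟨by simp [Nat.count_succ, h4, c1, hsp], by simpa [h4, h7] using c2,
        fun i' hi' h' => ?_⟩
      simp only [State.setReg_reg, State.setReg_arr, h4, h7]
      rcases Nat.lt_succ_iff_lt_or_eq.mp hi' with h'' | rfl
      · simpa using c3 i' h'' h'
      · exact absurd h' hsp

end EnvySearch

/-! ### Counting in base `S + 2 * k`, and turning digits into owners -/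

namespace EnvySearch

open RAM Finset

variable {n k S : ℕ} {W U X : ℕ → ℕ → ℕ} {s s' : State} {p : Prog}

/-- Move the digits in array `6` (in base given by register `6`) to the next number; register `20`
becomes `0` after the last number. -/
def increment : Prog :=
  .seq (.assign 21 (.const 1))
    (.seq (forUp 10 3 (.ite (.reg 21)
      (.ite (.eq (.add (.read 6 (.reg 10)) (.const 1)) (.reg 6)) (.store 6 (.reg 10) (.const 0))
        (.seq (.store 6 (.reg 10) (.add (.read 6 (.reg 10)) (.const 1))) (.assign 21 (.const 0))))
      .nop))
    (.assign 20 (.sub (.const 1) (.reg 21))))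

/-- The carry rule: passing from `x` to `x + 1`, a carry enters position `a` exactly if `Q ^ a ∣ x +
1`. The base `1` is treated apart, since there `1 % Q` is not `1`. -/
theorem digit_succ {Q x a : ℕ} (hQ : 0 < Q) :
    ((Q ^ a ∣ x + 1) → (x / Q ^ a % Q + 1 = Q → (x + 1) / Q ^ a % Q = 0 ∧ Q ^ (a + 1) ∣ x + 1) ∧
      (x / Q ^ a % Q + 1 ≠ Q →
        (x + 1) / Q ^ a % Q = x / Q ^ a % Q + 1 ∧ ¬ Q ^ (a + 1) ∣ x + 1)) ∧
    (¬ (Q ^ a ∣ x + 1) → (x + 1) / Q ^ a % Q = x / Q ^ a % Q ∧ ¬ Q ^ (a + 1) ∣ x + 1) := by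
  have hpow : 0 < Q ^ a := by positivity
  refine ⟨fun h => ?_, fun h => ⟨by rw [Nat.succ_div, if_neg h, add_zero], fun h' =>
    h ((pow_dvd_pow Q (Nat.le_succ a)).trans h')⟩⟩
  have h1 : (x + 1) / Q ^ a = x / Q ^ a + 1 := by rw [Nat.succ_div, if_pos h]
  have h2 : Q ^ (a + 1) ∣ x + 1 ↔ (x / Q ^ a + 1) % Q = 0 := by
    rw [← h1, ← Nat.dvd_iff_mod_eq_zero, pow_succ]
    exact (Nat.dvd_div_iff_mul_dvd h).symm
  rw [h1, h2, Nat.add_mod]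
  have h3 := Nat.mod_lt (x / Q ^ a) hQ
  constructor
  · intro h4
    rcases Nat.lt_or_ge 1 Q with h5 | h5
    · rw [Nat.mod_eq_of_lt h5, h4, Nat.mod_self]; simp
    · obtain rfl : Q = 1 := by omega
      simp [Nat.mod_one]
  · intro h4
    rw [Nat.mod_eq_of_lt (show 1 < Q by omega), Nat.mod_eq_of_lt (by omega)]
    simp

/-- Register `21` is the carry; a carry out of the last position means that all numbers have been
seen. The hypothesis `k ≤ Q` only ensures that the base is positive as soon as there is a digit. -/
theorem runs_increment {Q x : ℕ} (hk : s.reg 3 = k) (hQ : s.reg 6 = Q) (hQ0 : k ≤ Q)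
    (hx : ∀ a < k, s.arr 6 a = x / Q ^ a % Q) :
    Runs increment s (k * 60 + 20) fun s' =>
      (∀ a < k, s'.arr 6 a = (x + 1) / Q ^ a % Q) ∧ Flag (s'.reg 20) (¬ Q ^ k ∣ x + 1) := by
  refine (Runs.seq (T₂ := (k * (30 + 8) + 6) + 4) (Runs.assign ?_)).mono
    (by simp [Expr.cost]; omega)
  refine Runs.seq ((Runs.forUp (fun a s' => (∀ a' < k, s'.arr 6 a' =
    (if a' < a then x + 1 else x) / Q ^ a' % Q) ∧ Flag (s'.reg 21) (Q ^ a ∣ x + 1))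
    (show (s.setReg 21 ((Expr.const 1).eval s)).reg 3 = k from hk)
    (by decide) (by decide) (by decide) (by simpa [Expr.eval, Flag] using hx)
    fun a hak s₁ hr₁ ha₁ hI₁ => ?_).weaken le_rfl fun s₁ _ h => ?_)
  · have h6 : s₁.reg 6 = Q := by rw [ha₁.reg _ (by decide)]; exact hQ
    have hd := hI₁.1 a hak
    rw [if_neg (by omega)] at hd
    obtain ⟨g1, g2⟩ := digit_succ (Q := Q) (x := x) (a := a) (by omega)
    have hothers : ∀ a' < k, a' ≠ a →
        s₁.arr 6 a' = (if a' < a + 1 then x + 1 else x) / Q ^ a' % Q := by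
      intro a' ha' hne
      rw [hI₁.1 a' ha']
      have : a' < a + 1 ↔ a' < a := by omega
      simp [this]
    refine (Runs.ite (T₁ := 21) (T₂ := 1) (fun hb => ?_) (fun hb => ?_)).mono (by simp [Expr.cost])
    · have hdvd : Q ^ a ∣ x + 1 := by
        by_contra hn
        exact hb (hI₁.2.2 hn)
      obtain ⟨g3, g4⟩ := g1 hdvd
      refine (Runs.ite (T₁ := 3) (T₂ := 8) (fun hb => ?_) (fun hb => ?_)).mono (by simp [Expr.cost])
      · have he : x / Q ^ a % Q + 1 = Q := by
          by_contra hn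
          simp [Expr.eval, hr₁, hd, h6, hn] at hb
        refine (Runs.store ⟨fun a' ha' => ?_, ?_⟩).mono (by simp [Expr.cost])
        · simp only [State.setReg_arr, State.setArr_arr, Expr.eval, hr₁, true_and]
          split_ifs with h1 h2 h2
          · rw [h1, (g3 he).1]
          · omega
          · simpa [h2] using hothers a' ha' h1
          · simpa [h2] using hothers a' ha' h1
        · simpa using hI₁.2.congr ⟨fun _ => (g3 he).2, fun _ => hdvd⟩
      · have he : x / Q ^ a % Q + 1 ≠ Q := by
          intro hn
          simp [Expr.eval, hr₁, hd, h6, hn] at hb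
        refine (Runs.seq (Runs.store (Runs.assign ⟨fun a' ha' => ?_, ?_⟩))).mono
          (by simp [Expr.cost])
        · simp only [State.setReg_arr, State.setArr_arr, Expr.eval, hr₁, true_and, hd]
          split_ifs with h1 h2 h2
          · rw [h1, (g4 he).1]
          · omega
          · simpa [h2] using hothers a' ha' h1
          · simpa [h2] using hothers a' ha' h1
        · exact ⟨fun h => absurd h (g4 he).2, fun _ => by simp [Expr.eval]⟩
    · have hdvd : ¬ Q ^ a ∣ x + 1 := by
        intro hn
        have := hI₁.2.1 hn
        simp [Expr.eval, this] at hb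
      refine Runs.nop ⟨fun a' ha' => ?_, ?_⟩
      · by_cases h1 : a' = a
        · subst h1
          simp [hd, (g2 hdvd).1]
        · simpa using hothers a' ha' h1
      · simpa using hI₁.2.congr ⟨fun h => absurd h hdvd, fun h => absurd h (g2 hdvd).2⟩
  · refine (Runs.assign ⟨fun a ha => ?_, fun hn => ?_, fun hn => ?_⟩).mono (by simp [Expr.cost])
    · simpa [ha] using h.1 a ha
    · simp [Expr.eval, h.2.2 hn]
    · simp [Expr.eval, h.2.1 (not_not.mp hn)]

/-- Registers `4`, `5`, `6` hold `S`, `S + k` and `S + 2 * k`, and array `7` holds `S` agents. -/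
structure SearchEnv (n k S : ℕ) (W U : ℕ → ℕ → ℕ) (A : ℕ → ℕ) (s : State) : Prop
    extends Env n k W U s where
  n_pos : 0 < n
  S_eq : s.reg 4 = S
  Sk_eq : s.reg 5 = S + k
  base_eq : s.reg 6 = S + k + k
  arr_eq : s.arr 7 = A
  arr_lt : ∀ x < S, A x < n

variable {A : ℕ → ℕ}

theorem SearchEnv.agree (h : SearchEnv n k S W U A s) (ha : Agree p s s')
    (hp : (1 ∉ p.wr ∧ 3 ∉ p.wr ∧ 4 ∉ p.wr ∧ 5 ∉ p.wr ∧ 6 ∉ p.wr) ∧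
      1 ∉ p.wa ∧ 2 ∉ p.wa ∧ 4 ∉ p.wa ∧ 7 ∉ p.wa) : SearchEnv n k S W U A s' where
  toEnv := h.toEnv.agree ha ⟨⟨hp.1.1, hp.1.2.1⟩, hp.2.1, hp.2.2.1, hp.2.2.2.1⟩
  n_pos := h.n_pos
  S_eq := (ha.reg _ hp.1.2.2.1).trans h.S_eq
  Sk_eq := (ha.reg _ hp.1.2.2.2.1).trans h.Sk_eq
  base_eq := (ha.reg _ hp.1.2.2.2.2).trans h.base_eq
  arr_eq := (ha.arr _ hp.2.2.2.2).trans h.arr_eq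
  arr_lt := h.arr_lt

/-- The allocation of the items with a digit below `S`. -/
def firstAlloc (S : ℕ) (A d : ℕ → ℕ) (a : ℕ) : ℕ := if d a < S then A (d a) + 1 else 0

/-- Allocate the items with a digit below the content of register `4` to the agent of that number
in array `7`. -/
def allocFirst : Prog :=
  forUp 10 3 (.ite (.lt (.read 6 (.reg 10)) (.reg 4))
    (.store 5 (.reg 10) (.add (.read 7 (.read 6 (.reg 10))) (.const 1)))
    (.store 5 (.reg 10) (.const 0)))

theorem runs_allocFirst (hs : SearchEnv n k S W U A s) :
    Runs allocFirst s (k * 30 + 6) fun s' =>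
      ∀ a < k, s'.arr 5 a = firstAlloc S A (s.arr 6) a := by
  refine (Runs.forUp (T := 22) (fun a s' => ∀ a' < a, s'.arr 5 a' = firstAlloc S A (s.arr 6) a')
    hs.k_eq (by decide) (by decide) (by decide) (by simp) fun a hak s₁ hr₁ ha₁ hI₁ => ?_).mono
    (by omega)
  have hs₁ := hs.agree ha₁ (by decide)
  have h6 : s₁.arr 6 = s.arr 6 := ha₁.arr _ (by decide)
  have hb : (Expr.lt (.read 6 (.reg 10)) (.reg 4)).eval s₁ = if s.arr 6 a < S then 1 else 0 := by
    simp [Expr.eval, h6, hs₁.S_eq, hr₁]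
  refine (Runs.ite (T₁ := 7) (T₂ := 3) (fun h => ?_) (fun h => ?_)).mono (by simp [Expr.cost])
  · have hlt : s.arr 6 a < S := by
      by_contra hn; simp [hb, hn] at h
    refine (Runs.store fun a' ha' => ?_).mono (by simp [Expr.cost])
    simp only [State.setReg_arr, State.setArr_arr, Expr.eval, hr₁, true_and, h6, hs₁.arr_eq]
    split_ifs with h1
    · subst h1; simp [firstAlloc, hlt]
    · exact hI₁ a' (by omega)
  · have hlt : ¬ s.arr 6 a < S := by
      intro hn; simp [hb, hn] at h
    refine (Runs.store fun a' ha' => ?_).mono (by simp [Expr.cost])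
    simp only [State.setReg_arr, State.setArr_arr, Expr.eval, hr₁, true_and]
    split_ifs with h1
    · subst h1; simp [firstAlloc, hlt]
    · exact hI₁ a' (by omega)

/-- The value for `j` of the bundle of the item `a` and all items with digit `c + a`. -/
def joined (U : ℕ → ℕ → ℕ) (k c : ℕ) (d : ℕ → ℕ) (a j : ℕ) : ℕ :=
  U j a + ∑ a' ∈ range k, if d a' = c + a then U j a' else 0

/-- Compute in array `8` the values of the bundle of the item given by register `10`. -/
def joinValues : Prog :=
  forUp 11 1 (.seq (.store 8 (.reg 11) (.read 2 (addr 10 11)))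
    (forUp 12 3 (.ite (.eq (.read 6 (.reg 12)) (.add (.reg 5) (.reg 10)))
      (.store 8 (.reg 11) (.add (.read 8 (.reg 11)) (.read 2 (addr 12 11)))) .nop)))

theorem runs_joinValues {a : ℕ} (hs : SearchEnv n k S W U A s) (ha : s.reg 10 = a) (hak : a < k) :
    Runs joinValues s (n * (k * 40 + 30) + 6) fun s' =>
      ∀ j < n, s'.arr 8 j = joined U k (S + k) (s.arr 6) a j := by
  refine (Runs.forUp (T := 7 + (k * (20 + 8) + 6)) (fun j s' => ∀ j' < j, s'.arr 8 j' =
    joined U k (S + k) (s.arr 6) a j') hs.n_eq (by decide) (by decide) (by decide) (by simp)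
    fun j hj s₁ hr₁ ha₁ hI₁ => ?_).mono
    (Nat.add_le_add_right (Nat.mul_le_mul_left _ (by omega)) _)
  have hs₁ := hs.agree ha₁ (by decide)
  have h6 : s₁.arr 6 = s.arr 6 := ha₁.arr _ (by decide)
  have h10 : s₁.reg 10 = a := (ha₁.reg _ (by decide)).trans ha
  refine (Runs.seq (Runs.store ?_)).mono (by simp [Expr.cost]; rfl)
  set s₂ := s₁.setArr 8 ((Expr.reg 11).eval s₁) ((Expr.read 2 (addr 10 11)).eval s₁) with hs₂'
  have hs₂ : SearchEnv n k S W U A s₂ := by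
    refine hs₁.agree (p := .store 8 (.reg 11) (.read 2 (addr 10 11)))
      (Exec.agree (.store s₁ 8 (.reg 11) (.read 2 (addr 10 11)))) (by decide)
  have hr₂ : s₂.reg 11 = j := hr₁
  have g6 : s₂.arr 6 = s.arr 6 := h6
  have g10 : s₂.reg 10 = a := h10
  refine (Runs.forUp (fun x s' => (∀ j' < j, s'.arr 8 j' = joined U k (S + k) (s.arr 6) a j') ∧
      s'.arr 8 j = joined U x (S + k) (s.arr 6) a j)
    hs₂.k_eq (by decide) (by decide) (by decide) ⟨fun j' hj' => ?_, ?_⟩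
    fun x hx s₃ hr₃ ha₃ hI₃ => ?_).weaken le_rfl fun s₃ ha₃ h j' hj' => ?_
  · simp [s₂, hI₁ j' hj', Expr.eval, hr₁, hj'.ne]
  · simp [s₂, Expr.eval, hr₁, h10, joined, hs₁.row a (by omega), hs₁.U_eq a hak j hj]
  · have hs₃ := hs₂.agree ha₃ (by decide)
    have f6 : s₃.arr 6 = s.arr 6 := (ha₃.arr _ (by decide)).trans g6
    have f10 : s₃.reg 10 = a := (ha₃.reg _ (by decide)).trans g10
    have f11 : s₃.reg 11 = j := (ha₃.reg _ (by decide)).trans hr₂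
    have hb : (Expr.eq (.read 6 (.reg 12)) (.add (.reg 5) (.reg 10))).eval s₃ =
        if s.arr 6 x = S + k + a then 1 else 0 := by
      simp [Expr.eval, f6, f10, hs₃.Sk_eq, hr₃]
    refine (Runs.ite (T₁ := 10) (T₂ := 1) (fun h => ?_) (fun h => ?_)).mono (by simp [Expr.cost])
    · have he : s.arr 6 x = S + k + a := by
        by_contra hn; simp [hb, hn] at h
      refine (Runs.store ⟨fun j' hj' => ?_, ?_⟩).mono (by simp [Expr.cost])
      · simp [Expr.eval, f11, hj'.ne, hI₃.1 j' hj']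
      · simp [Expr.eval, f11, hI₃.2, hr₃, hs₃.row x (by omega), hs₃.U_eq x hx j hj, joined,
          sum_range_succ, he, add_assoc]
    · have he : ¬ s.arr 6 x = S + k + a := by
        intro hn; simp [hb, hn] at h
      refine Runs.nop ⟨by simpa using hI₃.1, ?_⟩
      simp [hI₃.2, joined, sum_range_succ, he]
  · simp only [State.setReg_arr]
    rcases Nat.lt_succ_iff_lt_or_eq.mp hj' with h' | rfl
    exacts [h.1 j' h', h.2]

/-- If the bundles have the values `X`, then agent `i` may receive a further bundle of values `v`
without being envied, as long as nobody loses. -/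
abbrev Feasible (n : ℕ) (X : ℕ → ℕ → ℕ) (v : ℕ → ℕ) (i : ℕ) : Prop :=
  ∀ j, j < n → X j i + v j ≤ X j j

/-- Allocate the item given by register `10` to the feasible agent whose rank is the digit of the
item minus the content of register `4`. -/
def pickFeasible : Prog :=
  .seq (.assign 22 (.const 0))
    -- The default is agent `0`, in case the rank exceeds the number of feasible agents: meaningless
    -- digits must still produce an allocation.
    (.seq (.store 5 (.reg 10) (.const 1))
      (forUp 11 1 (.seq (.assign 23 (.const 1))
        (.seq (forUp 12 1 (.ite (.lt (.read 3 (addr 12 12))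
            (.add (.read 3 (addr 12 11)) (.read 8 (.reg 12))))
          (.assign 23 (.const 0)) .nop))
        (.ite (.reg 23)
          (.seq (.ite (.eq (.add (.reg 4) (.reg 22)) (.read 6 (.reg 10)))
            (.store 5 (.reg 10) (.add (.reg 11) (.const 1))) .nop)
            (.assign 22 (.add (.reg 22) (.const 1))))
          .nop)))))

theorem runs_pickFeasible {a : ℕ} {v : ℕ → ℕ} (hs : SearchEnv n k S W U A s) (ha : s.reg 10 = a)
    (hX : ∀ i < n, ∀ j < n, s.arr 3 (i * n + j) = X i j) (hv : ∀ j < n, s.arr 8 j = v j) :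
    Runs pickFeasible s (n * (n * 40 + 50) + 20) fun s' =>
      (∀ a', a' ≠ a → s'.arr 5 a' = s.arr 5 a') ∧ 1 ≤ s'.arr 5 a ∧ s'.arr 5 a ≤ n ∧
      ∀ i < n, Feasible n X v i → S + Nat.count (Feasible n X v) i = s.arr 6 a →
        s'.arr 5 a = i + 1 := by
  refine (Runs.seq (T₂ := 3 + (n * ((2 + ((n * (22 + 8) + 6) + 25)) + 8) + 6))
    (Runs.assign ?_)).mono (by simp [Expr.cost]; nlinarith)
  refine Runs.seq (Runs.store ?_)
  set s₀ := (s.setReg 22 ((Expr.const 0).eval s)).setArr 5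
    ((Expr.reg 10).eval (s.setReg 22 ((Expr.const 0).eval s)))
    ((Expr.const 1).eval (s.setReg 22 ((Expr.const 0).eval s))) with hs₀'
  have hs₀ : SearchEnv n k S W U A s₀ :=
    hs.agree (Exec.agree (.seq (.assign s 22 (.const 0)) (.store _ 5 (.reg 10) (.const 1))))
      (by decide)
  have h3 : s₀.arr 3 = s.arr 3 := rfl
  have h6 : s₀.arr 6 = s.arr 6 := rfl
  have h8 : s₀.arr 8 = s.arr 8 := rfl
  have h10 : s₀.reg 10 = a := ha
  refine (Runs.forUp (fun i s' => s'.reg 22 = Nat.count (Feasible n X v) i ∧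
    (∀ a', a' ≠ a → s'.arr 5 a' = s.arr 5 a') ∧ 1 ≤ s'.arr 5 a ∧ s'.arr 5 a ≤ n ∧
      ∀ i' < i, Feasible n X v i' → S + Nat.count (Feasible n X v) i' = s.arr 6 a →
        s'.arr 5 a = i' + 1) hs₀.n_eq (by decide) (by decide) (by decide) ?_
      fun i hi s₁ hr₁ ha₁ hI₁ => ?_).weaken le_rfl fun s' _ h => h.2
  · refine ⟨by simp [s₀, Expr.eval], fun a' ha' => by simp [s₀, Expr.eval, ha, ha'], ?_, ?_,
      by simp⟩
    · simp [s₀, Expr.eval, ha]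
    · have := hs.n_pos
      simp [s₀, Expr.eval, ha]
      omega
  have hs₁ := hs₀.agree ha₁ (by decide)
  refine Runs.seq (Runs.assign ?_)
  set s₁' := s₁.setReg 23 ((Expr.const 1).eval s₁) with hs₁'
  have hs₂ : SearchEnv n k S W U A s₁' :=
    hs₁.agree (Exec.agree (.assign s₁ 23 (.const 1))) (by decide)
  have g3 : s₁'.arr 3 = s.arr 3 := (ha₁.arr 3 (by decide)).trans h3
  have g6 : s₁'.arr 6 = s.arr 6 := (ha₁.arr 6 (by decide)).trans h6
  have g8 : s₁'.arr 8 = s.arr 8 := (ha₁.arr 8 (by decide)).trans h8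
  have g10 : s₁'.reg 10 = a := (ha₁.reg 10 (by decide)).trans h10
  have g11 : s₁'.reg 11 = i := hr₁
  refine Runs.seq ((Runs.forUp (fun j s' => Flag (s'.reg 23) (∀ j', j' < j → X j' i + v j' ≤ X j' j'))
    hs₂.n_eq (by decide) (by decide) (by decide) (by simp [Flag, s₁', Expr.eval])
    fun j hj s₃ hr₃ ha₃ hI₃ => ?_).weaken le_rfl fun s₄ ha₄ h => ?_)
  · have hs₃ := hs₂.agree ha₃ (by decide)
    have f11 : s₃.reg 11 = i := (ha₃.reg 11 (by decide)).trans g11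
    have f3 : s₃.arr 3 = s.arr 3 := (ha₃.arr 3 (by decide)).trans g3
    have f8 : s₃.arr 8 = s.arr 8 := (ha₃.arr 8 (by decide)).trans g8
    have hb : (Expr.lt (.read 3 (addr 12 12))
            (.add (.read 3 (addr 12 11)) (.read 8 (.reg 12)))).eval s₃ =
        if X j j < X j i + v j then 1 else 0 := by
      simp [Expr.eval, hr₃, f11, f3, f8, hs₃.row j (by omega), hX j hj j hj, hX j hj i hi, hv j hj]
    refine (Runs.ite (T₁ := 2) (T₂ := 1) (fun h => ?_) (fun h => ?_)).mono (by simp [Expr.cost])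
    · have hlt : X j j < X j i + v j := by
        by_contra hlt; simp [hb, hlt] at h
      exact Runs.assign ⟨fun h' => absurd (h' j (by omega)) (by omega), fun _ => by
        simp [Expr.eval]⟩
    · have hle : X j i + v j ≤ X j j := by
        by_contra hlt; simp [hb] at h; omega
      refine Runs.nop ?_
      simp only [State.setReg_reg, if_neg (show (23 : ℕ) ≠ 12 by decide)]
      refine hI₃.congr ⟨fun h' j' hj' => ?_, fun h' j' hj' => h' j' (by omega)⟩
      rcases Nat.lt_succ_iff_lt_or_eq.mp hj' with h'' | rfl
      exacts [h' j' h'', hle]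
  · have f4 := (hs₂.agree ha₄ (by decide)).S_eq
    have f5 : s₄.arr 5 = s₁.arr 5 := ha₄.arr _ (by decide)
    have f6 : s₄.arr 6 = s.arr 6 := (ha₄.arr 6 (by decide)).trans g6
    have f10 : s₄.reg 10 = a := (ha₄.reg 10 (by decide)).trans g10
    have f11 : s₄.reg 11 = i := (ha₄.reg 11 (by decide)).trans g11
    have f22 : s₄.reg 22 = s₁.reg 22 := ha₄.reg 22 (by decide)
    obtain ⟨c1, c2, c3, c4, c5⟩ := hI₁
    refine (Runs.ite (T₁ := 20) (T₂ := 1) (fun h0 => ?_) (fun h0 => ?_)).mono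
      (by simp [Expr.cost])
    · have hf : Feasible n X v i := by
        by_contra hn
        exact h0 (h.2 hn)
      have hb : (Expr.eq (.add (.reg 4) (.reg 22)) (.read 6 (.reg 10))).eval s₄ =
          if S + Nat.count (Feasible n X v) i = s.arr 6 a then 1 else 0 := by
        simp [Expr.eval, f4, f22, c1, f6, f10]
      refine (Runs.seq (T₂ := 4) (Runs.ite (T₁ := 5) (T₂ := 1) (fun h1 => ?_) (fun h1 => ?_))).mono
        (by simp [Expr.cost])
      · have he : S + Nat.count (Feasible n X v) i = s.arr 6 a := by
          by_contra hn; simp [hb, hn] at h1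
        refine (Runs.store (Runs.assign ⟨?_, ?_, ?_, ?_, ?_⟩)).mono (by simp [Expr.cost])
        · simpa [Expr.eval, f22, c1, Nat.count_succ] using hf
        · intro a' ha'
          simp [Expr.eval, f10, ha', f5, c2 a' ha']
        · simp [Expr.eval, f10]
        · simpa [Expr.eval, f10, f11] using hi
        · intro i' hi' hf' he'
          -- Two feasible agents of the same rank coincide, so the cell is written for at most one
          -- agent.
          have : i' = i := Nat.count_injective hf' hf (by omega)
          simp [Expr.eval, f10, f11, this]
      · have he : ¬ S + Nat.count (Feasible n X v) i = s.arr 6 a := by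
          intro hn; simp [hb, hn] at h1
        refine Runs.nop ((Runs.assign ⟨?_, ?_, ?_, ?_, ?_⟩).mono (by simp [Expr.cost]))
        · simpa [Expr.eval, f22, c1, Nat.count_succ] using hf
        · simpa [f5] using c2
        · simpa [f5] using c3
        · simpa [f5] using c4
        · intro i' hi' hf' he'
          rcases Nat.lt_succ_iff_lt_or_eq.mp hi' with h'' | rfl
          · simpa [f5] using c5 i' h'' hf' he'
          · exact absurd he' he
    · have hf : ¬ Feasible n X v i := by
        intro hn
        have h1 := h.1 hn
        simp [Expr.eval, h1] at h0
      refine Runs.nop ⟨?_, ?_, ?_, ?_, ?_⟩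
      · simp [f22, c1, Nat.count_succ, hf]
      · simpa [f5] using c2
      · simpa [f5] using c3
      · simpa [f5] using c4
      · intro i' hi' hf' he'
        rcases Nat.lt_succ_iff_lt_or_eq.mp hi' with h'' | rfl
        · simpa [f5] using c5 i' h'' hf' he'
        · exact absurd hf' hf

end EnvySearch

/-! ### Evaluating one number, and running through all of them -/

namespace EnvySearch

open RAM Finset

variable {n k S : ℕ} {W U X : ℕ → ℕ → ℕ} {s s' : State} {p : Prog} {A : ℕ → ℕ}

/-- Allocate the items with a digit between the contents of registers `4` and `5`. -/
def allocLeaders : Prog :=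
  forUp 10 3 (.ite (.lt (.read 6 (.reg 10)) (.reg 4)) .nop
    (.ite (.lt (.read 6 (.reg 10)) (.reg 5)) (.seq joinValues pickFeasible) .nop))

theorem runs_allocLeaders (hs : SearchEnv n k S W U A s)
    (hX : ∀ i < n, ∀ j < n, s.arr 3 (i * n + j) = X i j) :
    Runs allocLeaders s (k * (n * (k * 40 + 30) + n * (n * 40 + 50) + 60) + 6) fun s' =>
      (∀ a < k, ¬ (S ≤ s.arr 6 a ∧ s.arr 6 a < S + k) → s'.arr 5 a = s.arr 5 a) ∧
      ∀ a < k, S ≤ s.arr 6 a → s.arr 6 a < S + k → 1 ≤ s'.arr 5 a ∧ s'.arr 5 a ≤ n ∧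
        ∀ i < n, Feasible n X (joined U k (S + k) (s.arr 6) a) i →
          S + Nat.count (Feasible n X (joined U k (S + k) (s.arr 6) a)) i = s.arr 6 a →
            s'.arr 5 a = i + 1 := by
  refine (Runs.forUp (T := 12 + (n * (k * 40 + 30) + 6 + (n * (n * 40 + 50) + 20)) + 1)
    (fun b s' => (∀ a < k, ¬ (S ≤ s.arr 6 a ∧ s.arr 6 a < S + k) → s'.arr 5 a = s.arr 5 a) ∧
      ∀ a < b, S ≤ s.arr 6 a → s.arr 6 a < S + k → 1 ≤ s'.arr 5 a ∧ s'.arr 5 a ≤ n ∧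
        ∀ i < n, Feasible n X (joined U k (S + k) (s.arr 6) a) i →
          S + Nat.count (Feasible n X (joined U k (S + k) (s.arr 6) a)) i = s.arr 6 a →
            s'.arr 5 a = i + 1)
    hs.k_eq (by decide) (by decide) (by decide) (by simp) fun b hbk s₁ hr₁ ha₁ hI₁ => ?_).mono
    (Nat.add_le_add_right (Nat.mul_le_mul_left _ (by omega)) _)
  have hs₁ := hs.agree ha₁ (by decide)
  have h6 : s₁.arr 6 = s.arr 6 := ha₁.arr _ (by decide)
  have h3 : s₁.arr 3 = s.arr 3 := ha₁.arr _ (by decide)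
  have hb : (Expr.lt (.read 6 (.reg 10)) (.reg 4)).eval s₁ = if s.arr 6 b < S then 1 else 0 := by
    simp [Expr.eval, h6, hs₁.S_eq, hr₁]
  have hb' : (Expr.lt (.read 6 (.reg 10)) (.reg 5)).eval s₁ =
      if s.arr 6 b < S + k then 1 else 0 := by
    simp [Expr.eval, h6, hs₁.Sk_eq, hr₁]
  obtain ⟨c1, c2⟩ := hI₁
  have hskip : ¬ (S ≤ s.arr 6 b ∧ s.arr 6 b < S + k) → Runs .nop s₁ 1 fun s'' =>
      (∀ a < k, ¬ (S ≤ s.arr 6 a ∧ s.arr 6 a < S + k) →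
        (s''.setReg 10 (b + 1)).arr 5 a = s.arr 5 a) ∧
      ∀ a < b + 1, S ≤ s.arr 6 a → s.arr 6 a < S + k → 1 ≤ (s''.setReg 10 (b + 1)).arr 5 a ∧
        (s''.setReg 10 (b + 1)).arr 5 a ≤ n ∧
        ∀ i < n, Feasible n X (joined U k (S + k) (s.arr 6) a) i →
          S + Nat.count (Feasible n X (joined U k (S + k) (s.arr 6) a)) i = s.arr 6 a →
            (s''.setReg 10 (b + 1)).arr 5 a = i + 1 := by
    refine fun hn => Runs.nop ⟨c1, fun a ha h1 h2 => ?_⟩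
    rcases Nat.lt_succ_iff_lt_or_eq.mp ha with h' | rfl
    · exact c2 a h' h1 h2
    · exact absurd ⟨h1, h2⟩ hn
  refine (Runs.ite (T₁ := 1)
    (T₂ := 5 + (n * (k * 40 + 30) + 6 + (n * (n * 40 + 50) + 20) + 1)) (fun h => ?_)
    (fun h => ?_)).mono (by simp [Expr.cost]; omega)
  · refine hskip fun hn => h ?_
    rw [hb, if_neg (by omega)]
  have hSd : S ≤ s.arr 6 b := by
    by_contra hn; simp [hb] at h; omega
  refine (Runs.ite (T₂ := 1) (fun h' => ?_) (fun h' => ?_)).mono (by simp [Expr.cost]; rfl)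
  · have hdS : s.arr 6 b < S + k := by
      by_contra hn; simp [hb', hn] at h'
    refine Runs.seq ((runs_joinValues hs₁ hr₁ hbk).weaken le_rfl fun s₂ ha₂ hv => ?_)
    have hs₂ := hs₁.agree ha₂ (by decide)
    have g3 : s₂.arr 3 = s.arr 3 := (ha₂.arr 3 (by decide)).trans h3
    have g5 : s₂.arr 5 = s₁.arr 5 := ha₂.arr 5 (by decide)
    have g6 : s₂.arr 6 = s.arr 6 := (ha₂.arr 6 (by decide)).trans h6
    have g10 : s₂.reg 10 = b := (ha₂.reg 10 (by decide)).trans hr₁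
    refine (runs_pickFeasible hs₂ g10 (by simpa only [g3] using hX) hv).weaken le_rfl
      fun s₃ _ h => ?_
    obtain ⟨e1, e2⟩ := h
    rw [h6, g6] at e2
    refine ⟨fun a ha hn => ?_, fun a ha h1 h2 => ?_⟩
    · have : a ≠ b := by rintro rfl; exact hn ⟨hSd, hdS⟩
      simp [e1 a this, g5, c1 a ha hn]
    · rcases Nat.lt_succ_iff_lt_or_eq.mp ha with h' | rfl
      · simpa [e1 a h'.ne, g5] using c2 a h' h1 h2
      · exact e2
  · refine hskip fun hn => ?_
    rw [hb', if_pos hn.2] at h'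
    omega

/-- Allocate the remaining items to the agent of the item that their digit points to. -/
def allocJoined : Prog :=
  forUp 10 3 (.ite (.lt (.read 6 (.reg 10)) (.reg 5)) .nop
    -- A digit may point to an item that is no leader and still has no owner (`0`); adding the truth
    -- value of that case replaces it by agent `0`, stored as `1`.
    (.store 5 (.reg 10) (.add (.read 5 (.sub (.read 6 (.reg 10)) (.reg 5)))
      (.eq (.read 5 (.sub (.read 6 (.reg 10)) (.reg 5))) (.const 0)))))

theorem runs_allocJoined (hs : SearchEnv n k S W U A s) (hd : ∀ a < k, s.arr 6 a < S + k + k)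
    (h5 : ∀ a < k, s.arr 5 a ≤ n) (h5' : ∀ a < k, s.arr 6 a < S + k → 1 ≤ s.arr 5 a) :
    Runs allocJoined s (k * 40 + 6) fun s' => (∀ a < k, 1 ≤ s'.arr 5 a ∧ s'.arr 5 a ≤ n) ∧
      (∀ a < k, s.arr 6 a < S + k → s'.arr 5 a = s.arr 5 a) ∧
      ∀ a < k, ∀ l < k, s.arr 6 a = S + k + l → s.arr 6 l < S + k →
        s'.arr 5 a = s.arr 5 l := by
  refine (Runs.forUp (T := 30) (fun b s' => (∀ a < k, s'.arr 5 a ≤ n) ∧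
    (∀ a < b, 1 ≤ s'.arr 5 a) ∧
      (∀ a < k, s.arr 6 a < S + k → s'.arr 5 a = s.arr 5 a) ∧
      ∀ a < b, ∀ l < k, s.arr 6 a = S + k + l → s.arr 6 l < S + k →
        s'.arr 5 a = s.arr 5 l)
    hs.k_eq (by decide) (by decide) (by decide) (by simpa using h5)
    fun b hbk s₁ hr₁ ha₁ hI₁ => ?_).weaken
    (by omega) fun s' _ h => ⟨fun a ha => ⟨h.2.1 a ha, h.1 a ha⟩, h.2.2.1, h.2.2.2⟩
  have hs₁ := hs.agree ha₁ (by decide)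
  have h6 : s₁.arr 6 = s.arr 6 := ha₁.arr _ (by decide)
  have hb : (Expr.lt (.read 6 (.reg 10)) (.reg 5)).eval s₁ =
      if s.arr 6 b < S + k then 1 else 0 := by
    simp [Expr.eval, h6, hs₁.Sk_eq, hr₁]
  obtain ⟨c1, c2, c3, c4⟩ := hI₁
  refine (Runs.ite (T₁ := 1) (T₂ := 20) (fun h => ?_) (fun h => ?_)).mono (by simp [Expr.cost])
  · have hlt : s.arr 6 b < S + k := by
      by_contra hn; simp [hb, hn] at h
    refine Runs.nop ⟨c1, fun a ha => ?_, c3, fun a ha l hl hal hl' => ?_⟩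
    · rcases Nat.lt_succ_iff_lt_or_eq.mp ha with h' | rfl
      · exact c2 a h'
      · simpa [c3 a hbk hlt] using h5' a hbk hlt
    · rcases Nat.lt_succ_iff_lt_or_eq.mp ha with h' | rfl
      · exact c4 a h' l hl hal hl'
      · omega
  · have hlt : ¬ s.arr 6 b < S + k := by
      intro hn; simp [hb, hn] at h
    have hx : s.arr 6 b - (S + k) < k := by have := hd b hbk; omega
    have hn := hs.n_pos
    have hc := c1 _ hx
    set e := s₁.arr 5 (s.arr 6 b - (S + k)) + if s₁.arr 5 (s.arr 6 b - (S + k)) = 0 then 1 else 0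
      with he
    have he1 : 1 ≤ e ∧ e ≤ n := by rw [he]; split_ifs <;> omega
    refine (Runs.store ?_).mono (by simp [Expr.cost])
    simp only [Expr.eval, hr₁, h6, hs₁.Sk_eq, State.setReg_arr, State.setArr_arr, true_and, ← he]
    refine ⟨fun a ha => ?_, fun a ha => ?_, fun a ha h1 => ?_, fun a ha l hl hal hl' => ?_⟩
    · split_ifs
      exacts [he1.2, c1 a ha]
    · split_ifs
      exacts [he1.1, c2 a (by omega)]
    · rw [if_neg (by rintro rfl; exact hlt h1), c3 a ha h1]
    · split_ifs with hab
      · subst hab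
        have h1 : s.arr 6 a - (S + k) = l := by omega
        have h2 := h5' l hl hl'
        rw [h1, c3 l hl hl', if_neg (by omega)] at he
        exact he
      · exact c4 a (by omega) l hl hal hl'

/-- The allocation `f` of the open items is envy-free. -/
def NoEnvy (n k : ℕ) (W U : ℕ → ℕ → ℕ) (f : ℕ → ℕ) : Prop :=
  ∀ i < n, ∀ j < n, extend W U k f i j ≤ extend W U k f i i

theorem extend_congr {f g : ℕ → ℕ} (h : ∀ a < k, f a = g a) : extend W U k f = extend W U k g := by
  funext i j
  unfold extend
  congr 1
  exact sum_congr rfl fun a ha => by rw [h a (mem_range.mp ha)]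

theorem joined_congr {c : ℕ} {d e : ℕ → ℕ} (h : ∀ a < k, d a = e a) :
    joined U k c d = joined U k c e := by
  funext a j
  unfold joined
  congr 1
  exact sum_congr rfl fun a ha => by rw [h a (mem_range.mp ha)]

theorem NoEnvy.congr {f g : ℕ → ℕ} (hf : NoEnvy n k W U f) (h : ∀ a < k, f a = g a) :
    NoEnvy n k W U g := by
  unfold NoEnvy
  rwa [← extend_congr h]

/-- The digits `d` describe the allocation `f`. -/
def Decodes (n k S : ℕ) (W U : ℕ → ℕ → ℕ) (A d f : ℕ → ℕ) : Prop :=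
  ∀ a < k, (d a < S ∧ f a = A (d a) + 1) ∨
    (S ≤ d a ∧ d a < S + k ∧ ∃ i < n, f a = i + 1 ∧
      Feasible n (extend W U k (firstAlloc S A d)) (joined U k (S + k) d a) i ∧
      S + Nat.count (Feasible n (extend W U k (firstAlloc S A d)) (joined U k (S + k) d a)) i =
        d a) ∨
    (∃ l < k, d a = S + k + l ∧ d l < S + k ∧ f a = f l)

theorem Decodes.congr {d e f : ℕ → ℕ} (hd : Decodes n k S W U A d f) (h : ∀ a < k, d a = e a) :
    Decodes n k S W U A e f := by
  have h1 : extend W U k (firstAlloc S A d) = extend W U k (firstAlloc S A e) :=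
    extend_congr fun a ha => by rw [firstAlloc, firstAlloc, h a ha]
  intro a ha
  rcases hd a ha with h' | h' | ⟨l, hl, h'⟩
  · exact Or.inl (by rwa [← h a ha])
  · refine Or.inr (Or.inl ?_)
    simpa only [← h a ha, ← joined_congr h, ← h1] using h'
  · exact Or.inr (Or.inr ⟨l, hl, by rwa [← h a ha, ← h l hl]⟩)

/-- Set register `9` to `1` if the allocation given by the digits is envy-free. -/
def evaluate : Prog :=
  -- The first `build` takes only the items of special agents into account, and all groups are
  -- tested against these values, independently of each other. The second one prepares the final
  -- check.
  .seq allocFirst (.seq build (.seq allocLeaders (.seq allocJoined (.seq build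
    (.seq check (.ite (.reg 23) (.assign 9 (.const 1)) .nop))))))

/-- Whatever the digits are, `f` is a genuine allocation, so a successful check proves a
yes-instance. Only for digits that decode some `g` does one need to know which allocation was built.
-/
theorem runs_evaluate (hs : SearchEnv n k S W U A s) (hd : ∀ a < k, s.arr 6 a < S + k + k) :
    Runs evaluate s (500 * ((k + 1) ^ 2 * (n + 1) ^ 2)) fun s' => ∃ f : ℕ → ℕ,
      (∀ a < k, 1 ≤ f a ∧ f a ≤ n) ∧
      (∀ g, Decodes n k S W U A (s.arr 6) g → ∀ a < k, f a = g a) ∧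
      (NoEnvy n k W U f → s'.reg 9 = 1) ∧ (¬ NoEnvy n k W U f → s'.reg 9 = s.reg 9) := by
  refine (Runs.seq ((runs_allocFirst hs).weaken le_rfl fun s₁ ha₁ h₁ => Runs.seq
    (T₁ := n * (n * 20 + 20) + k * (n * 40 + 30) + 20) (T₂ := (k * (n * (k * 40 + 30) + n * (n * 40 + 50) + 60) + 6) + ((k * 40 + 6) +
      ((n * (n * 20 + 20) + k * (n * 40 + 30) + 20) + ((n * (n * 30 + 20) + 20) + 9)))) ?_)).mono
    (by nlinarith [Nat.zero_le (n * k), Nat.zero_le (n * n * k), Nat.zero_le (n * k * k),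
      Nat.zero_le (n * n * k * k)])
  have hs₁ := hs.agree ha₁ (by decide)
  have d₁ : s₁.arr 6 = s.arr 6 := ha₁.arr 6 (by decide)
  have hf1 : ∀ a < k, firstAlloc S A (s.arr 6) a ≤ n := fun a ha => by
    unfold firstAlloc
    split_ifs with h
    · exact hs.arr_lt _ h
    · omega
  refine (runs_build hs₁.toEnv fun a ha => by rw [h₁ a ha]; exact hf1 a ha).weaken le_rfl
    fun s₂ ha₂ h₂ => ?_
  rw [extend_congr h₁] at h₂
  have hs₂ := hs₁.agree ha₂ (by decide)
  have d₂ : s₂.arr 6 = s.arr 6 := (ha₂.arr 6 (by decide)).trans d₁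
  have f₂ : s₂.arr 5 = s₁.arr 5 := ha₂.arr 5 (by decide)
  refine Runs.seq ((runs_allocLeaders hs₂ h₂).weaken le_rfl fun s₃ ha₃ h₃ => ?_)
  have hs₃ := hs₂.agree ha₃ (by decide)
  have d₃ : s₃.arr 6 = s.arr 6 := (ha₃.arr 6 (by decide)).trans d₂
  obtain ⟨h₃, h₃'⟩ := h₃
  rw [d₂, f₂] at h₃
  rw [d₂] at h₃'
  refine Runs.seq ((runs_allocJoined hs₃ (by rwa [d₃]) (fun a ha => ?_)
    (fun a ha h => ?_)).weaken le_rfl fun s₄ ha₄ h₄ => ?_)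
  · by_cases hl : S ≤ s.arr 6 a ∧ s.arr 6 a < S + k
    · exact (h₃' a ha hl.1 hl.2).2.1
    · rw [h₃ a ha hl, h₁ a ha]
      exact hf1 a ha
  · rw [d₃] at h
    by_cases hl : S ≤ s.arr 6 a
    · exact (h₃' a ha hl h).1
    · rw [h₃ a ha (by omega), h₁ a ha, firstAlloc, if_pos (by omega)]
      omega
  have hs₄ := hs₃.agree ha₄ (by decide)
  obtain ⟨h₄, e₄, e₄'⟩ := h₄
  rw [d₃] at e₄ e₄'
  refine Runs.seq ((runs_build hs₄.toEnv fun a ha => (h₄ a ha).2).weaken le_rfl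
    fun s₅ ha₅ h₅ => ?_)
  have hs₅ := hs₄.agree ha₅ (by decide)
  refine Runs.seq ((runs_check hs₅.toEnv h₅).weaken le_rfl fun s₆ ha₆ h₆ => ?_)
  have h9 : s₆.reg 9 = s.reg 9 := by
    rw [ha₆.reg _ (by decide), ha₅.reg _ (by decide), ha₄.reg _ (by decide),
      ha₃.reg _ (by decide), ha₂.reg _ (by decide), ha₁.reg _ (by decide)]
  have hdec : ∀ g, Decodes n k S W U A (s.arr 6) g → ∀ a < k, s₄.arr 5 a = g a := by
    intro g hg
    have key : ∀ a < k, s.arr 6 a < S + k → s₃.arr 5 a = g a := by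
      intro a ha hlt
      rcases hg a ha with ⟨g1, g2⟩ | ⟨g1, g2, i, hi, g3, g4, g5⟩ | ⟨l, hl, g1, g2, g3⟩
      · rw [h₃ a ha (by omega), h₁ a ha, firstAlloc, if_pos g1, g2]
      · rw [(h₃' a ha g1 g2).2.2 i hi g4 g5, g3]
      · omega
    intro a ha
    by_cases hlt : s.arr 6 a < S + k
    · rw [e₄ a ha hlt, key a ha hlt]
    · rcases hg a ha with ⟨g1, g2⟩ | ⟨g1, g2, _⟩ | ⟨l, hl, g1, g2, g3⟩
      · omega
      · omega
      · rw [e₄' a ha l hl g1 g2, key l hl g2, g3]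
  refine (Runs.ite (T₁ := 2) (T₂ := 1) (fun h => ?_) (fun h => ?_)).mono (by simp [Expr.cost])
  · have hef : NoEnvy n k W U (s₄.arr 5) := by
      by_contra hn; exact h (h₆.2 hn)
    exact Runs.assign ⟨_, h₄, hdec, fun _ => by simp [Expr.eval], fun h => absurd hef h⟩
  · have hef : ¬ NoEnvy n k W U (s₄.arr 5) := by
      intro hn; have := h₆.1 hn; simp [Expr.eval, this] at h
    exact Runs.nop ⟨_, h₄, hdec, fun h => absurd h hef, fun _ => h9⟩

/-- Evaluate all numbers with `k` digits, starting with zero. -/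
def enumerate : Prog :=
  .seq (.assign 9 (.const 0)) (.seq (.assign 20 (.const 1))
    (.loop (.reg 20) (.seq evaluate increment)))

/-- Round `x` evaluates the number `x`, whose base `Q` digits are in array `6`; the invariant
records that every `x' < x` which decodes an envy-free allocation has been noticed. -/
theorem runs_enumerate (hs : SearchEnv n k S W U A s) (h0 : ∀ a < k, s.arr 6 a = 0) :
    Runs enumerate s ((S + k + k) ^ k * (600 * ((k + 1) ^ 2 * (n + 1) ^ 2)) + 20) fun s' =>
      s'.reg 9 ≤ 1 ∧
      (s'.reg 9 = 1 → ∃ f : ℕ → ℕ, (∀ a < k, 1 ≤ f a ∧ f a ≤ n) ∧ NoEnvy n k W U f) ∧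
      ∀ d, (∀ a < k, d a < S + k + k) → ∀ f, Decodes n k S W U A d f → NoEnvy n k W U f →
        s'.reg 9 = 1 := by
  set Q := S + k + k with hQ
  -- Without open items there is still the empty number to evaluate, even if `Q = 0`.
  have hN : 0 < Q ^ k := by
    rcases Nat.eq_zero_or_pos k with rfl | hk
    · simp
    · exact Nat.pow_pos (by omega)
  refine (Runs.seq (Runs.assign (Runs.seq (Runs.assign ((Runs.loop
    (T := 500 * ((k + 1) ^ 2 * (n + 1) ^ 2) + (k * 60 + 20)) (Q ^ k)
    (fun x s' => SearchEnv n k S W U A s' ∧ x ≤ Q ^ k ∧ (∀ a < k, s'.arr 6 a = x / Q ^ a % Q) ∧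
      Flag (s'.reg 20) (x ≠ Q ^ k) ∧ s'.reg 9 ≤ 1 ∧
      (s'.reg 9 = 1 → ∃ f : ℕ → ℕ, (∀ a < k, 1 ≤ f a ∧ f a ≤ n) ∧ NoEnvy n k W U f) ∧
      ∀ x' < x, ∀ f, Decodes n k S W U A (fun a => x' / Q ^ a % Q) f → NoEnvy n k W U f →
        s'.reg 9 = 1) ?_ ?_ ?_).weaken le_rfl ?_))))).mono ?_
  · rintro x hx s₁ ⟨c1, c2, c3, c4, c5, c6, c7⟩
    refine ⟨by simp [Expr.eval, c4.1 hx.ne], Runs.seq ((runs_evaluate c1 fun a ha => ?_).weaken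
      le_rfl fun s₂ ha₂ h₂ => ?_)⟩
    · rw [c3 a ha]
      exact Nat.mod_lt _ (by omega)
    have hs₂ := c1.agree ha₂ (by decide)
    have d₂ : s₂.arr 6 = s₁.arr 6 := ha₂.arr 6 (by decide)
    obtain ⟨f, hf1, hf2, hf3, hf4⟩ := h₂
    refine (runs_increment hs₂.k_eq hs₂.base_eq (by omega) (by rw [d₂]; exact c3)).weaken le_rfl
      fun s₃ ha₃ h₃ => ?_
    have h9 : s₃.reg 9 = s₂.reg 9 := ha₃.reg _ (by decide)
    have h9' : s₂.reg 9 = 1 ∨ s₂.reg 9 = s₁.reg 9 := by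
      by_cases h : NoEnvy n k W U f
      exacts [Or.inl (hf3 h), Or.inr (hf4 h)]
    refine ⟨hs₂.agree ha₃ (by decide), hx, h₃.1, h₃.2.congr (not_congr ⟨fun h => ?_, fun h => ?_⟩),
      by omega, fun h => ?_, fun x' hx' g hg hg' => ?_⟩
    · exact le_antisymm hx (Nat.le_of_dvd (by omega) h)
    · rw [h]
    · by_cases hf : NoEnvy n k W U f
      · exact ⟨f, hf1, hf⟩
      · exact c6 (by rw [← hf4 hf, ← h9, h])
    · rcases Nat.lt_succ_iff_lt_or_eq.mp hx' with h' | rfl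
      · have := c7 x' h' g hg hg'
        omega
      · rw [h9]
        have h2 : Decodes n k S W U A (s₁.arr 6) g := hg.congr fun a ha => (c3 a ha).symm
        exact hf3 (hg'.congr fun a ha => (hf2 g h2 a ha).symm)
  · rintro s₁ ⟨_, _, _, c4, _⟩
    simp [Expr.eval, c4.2 (by simp)]
  · refine ⟨hs.agree (Exec.agree (.seq (.assign s 9 (.const 0)) (.assign _ 20 (.const 1))))
      (by decide), by omega, by simpa using h0, ⟨fun _ => by simp [Expr.eval],
        fun h => absurd hN.ne h⟩, by simp [Expr.eval], by simp [Expr.eval], by simp⟩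
  · rintro s₁ - ⟨_, _, _, _, c5, c6, c7⟩
    refine ⟨c5, c6, fun d hd f hdf hf => ?_⟩
    -- The number with the digits `d` lies below `Q ^ k`, so it was met in the enumeration.
    have hx := (finFunctionFinEquiv (m := Q) (n := k) fun a => ⟨d a, hd a a.2⟩).2
    refine c7 _ hx f (hdf.congr fun a ha => ?_) hf
    have h1 := congrFun (finFunctionFinEquiv.symm_apply_apply
      (fun a : Fin k => (⟨d a, hd a a.2⟩ : Fin Q))) ⟨a, ha⟩
    have h2 := congrArg Fin.val h1
    rw [finFunctionFinEquiv_symm_apply_val] at h2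
    exact h2.symm
  · simp only [Expr.cost]
    have h1 : k ≤ (k + 1) ^ 2 * (n + 1) ^ 2 := by nlinarith [Nat.zero_le ((k+1)^2 * (n^2 + 2 * n))]
    have h2 : 1 ≤ (k + 1) ^ 2 * (n + 1) ^ 2 := Nat.one_le_iff_ne_zero.mpr (by positivity)
    have h3 : Q ^ k * (1 + 1 + (500 * ((k + 1) ^ 2 * (n + 1) ^ 2) + (k * 60 + 20))) ≤
        Q ^ k * (600 * ((k + 1) ^ 2 * (n + 1) ^ 2)) := Nat.mul_le_mul_left _ (by omega)
    omega

end EnvySearch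

/-! ### Combinatorics: few envious and special agents, and every yes-instance has a decodable
solution -/

namespace EnvySearch

open RAM Finset

variable {n k S : ℕ} {W U : ℕ → ℕ → ℕ} {A f : ℕ → ℕ}

theorem extend_eq_of_forall_ne {i j : ℕ} (h : ∀ a < k, f a ≠ j + 1) :
    extend W U k f i j = W i j := by
  unfold extend
  rw [sum_eq_zero fun a ha => if_neg (h a (mem_range.mp ha)), add_zero]

/-- Without an open item `i` keeps the value `W i i`, while the bundle she envies can only grow. -/
theorem NoEnvy.exists_of_envious (hf : NoEnvy n k W U f) {i : ℕ} (hi : i < n)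
    (h : Envious n W i) : ∃ a < k, f a = i + 1 := by
  by_contra! hn
  obtain ⟨j, hj, hlt⟩ := h
  have h1 := hf i hi j hj
  rw [extend_eq_of_forall_ne hn] at h1
  have : W i j ≤ extend W U k f i j := Nat.le_add_right _ _
  omega

theorem NoEnvy.count_envious_le (hf : NoEnvy n k W U f) : Nat.count (Envious n W) n ≤ k := by
  rw [Nat.count_eq_card_filter_range]
  calc _ ≤ ((range k).image fun a => f a - 1).card := card_le_card fun i hi => by
        obtain ⟨hi, he⟩ := mem_filter.mp hi
        obtain ⟨a, ha, h⟩ := hf.exists_of_envious (mem_range.mp hi) he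
        exact mem_image.mpr ⟨a, mem_range.mpr ha, by omega⟩
    _ ≤ k := card_image_le.trans (card_range k).le

/-- With more than `k` rivals, some rival `i'` receives no open item. She has `W i' i' ≤ W i' i < W
i' i + U i' a`, so she envies `i`. -/
theorem NoEnvy.special (hf : NoEnvy n k W U f) {i a : ℕ} (ha : a < k) (hi : i < n)
    (hfa : f a = i + 1) (hU : 0 < U i a) : Special n k W U i := by
  refine ⟨a, ha, hU, ?_⟩
  by_contra! hlt
  rw [rivals, Nat.count_eq_card_filter_range] at hlt
  have hk : ((range k).image fun a => f a - 1).card ≤ k := card_image_le.trans (card_range k).le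
  obtain ⟨i', h1, h2⟩ := exists_mem_notMem_of_card_lt_card (hk.trans_lt hlt)
  obtain ⟨hi', hW, hU'⟩ := mem_filter.mp h1
  have h3 := hf i' (mem_range.mp hi') i hi
  rw [extend_eq_of_forall_ne (j := i') fun a' ha' h =>
    h2 (mem_image.mpr ⟨a', mem_range.mpr ha', by omega⟩)] at h3
  have h4 : U i' a ≤ ∑ a' ∈ range k, if f a' = i + 1 then U i' a' else 0 := by
    have := single_le_sum (f := fun a' => if f a' = i + 1 then U i' a' else 0)
      (fun _ _ => Nat.zero_le _) (mem_range.mpr ha)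
    simpa [hfa] using this
  unfold extend at h3
  omega

/-- Let `i` be special by the item `a` and not envious. A non-envious `i'` of the same type has `W
i' i' = W i i' ≤ W i i = W i' i` and values `a` as `i` does, so she is one of the at most `k` rivals
of `i`. Hence there are at most `k` non-envious special agents of each type, and at most `k` envious
agents in addition. -/
theorem count_special_le {τ : Type*} [DecidableEq τ] (ty : ℕ → τ)
    (hty : ∀ i < n, ∀ i' < n, ty i = ty i' → (∀ j < n, W i j = W i' j) ∧ ∀ a < k, U i a = U i' a)
    (he : Nat.count (Envious n W) n ≤ k) :
    Nat.count (Special n k W U) n ≤ k * ((range n).image ty).card + k := by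
  rw [Nat.count_eq_card_filter_range] at he ⊢
  have h1 : (range n).filter (Special n k W U) ⊆
      (range n).filter (fun i => Special n k W U i ∧ ¬ Envious n W i) ∪
        (range n).filter (Envious n W) := by
    intro i hi
    rw [mem_union, mem_filter, mem_filter]
    obtain ⟨hi, hs⟩ := mem_filter.mp hi
    by_cases h : Envious n W i
    exacts [Or.inr ⟨hi, h⟩, Or.inl ⟨hi, hs, h⟩]
  refine (card_le_card h1).trans ((card_union_le _ _).trans (add_le_add ?_ he))
  refine (card_le_mul_card_image (f := ty) _ k fun b hb => ?_).trans
    (Nat.mul_le_mul_left _ (card_le_card (image_subset_image (filter_subset _ _))))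
  obtain ⟨i, hi, rfl⟩ := mem_image.mp hb
  obtain ⟨hi, ⟨a, ha, hU, hr⟩, hne⟩ := mem_filter.mp hi
  rw [rivals, Nat.count_eq_card_filter_range] at hr
  refine (card_le_card fun i' hi' => ?_).trans hr
  obtain ⟨hi', hti⟩ := mem_filter.mp hi'
  obtain ⟨hi', -, -⟩ := mem_filter.mp hi'
  have hi := mem_range.mp hi
  have hi'' := mem_range.mp hi'
  obtain ⟨hW, hU'⟩ := hty i' hi'' i hi hti
  refine mem_filter.mpr ⟨hi', ?_, by rwa [hU' a ha]⟩
  rw [hW i' hi'', hW i hi]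
  by_contra hn
  exact hne ⟨i', hi'', by omega⟩

/-- The filter selects the first `k` elements of `p` below `n`, or all of them if there are fewer.
-/
theorem card_filter_count_lt (p : ℕ → Prop) [DecidablePred p] (k n : ℕ) :
    ((range n).filter fun i => p i ∧ Nat.count p i < k).card = min k (Nat.count p n) := by
  induction n with
  | zero => simp
  | succ n ih =>
    rw [range_add_one, filter_insert, Nat.count_succ]
    split_ifs with h1 h2 h2
    · rw [card_insert_of_notMem (by simp), ih]
      omega
    · exact absurd h1.1 h2
    · rw [ih]
      have : k ≤ Nat.count p n := by
        by_contra hn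
        exact h1 ⟨h2, by omega⟩
      omega
    · rw [ih, add_zero]

/-- Agents can be chosen among the first `k` candidates of each of at most `k` elements. -/
theorem exists_injective_count_lt {ι : Type*} [Fintype ι] (hι : Fintype.card ι ≤ k)
    (p : ι → ℕ → Prop) [∀ l, DecidablePred (p l)] {π : ι → ℕ} (hπ : Function.Injective π)
    (hn : ∀ l, π l < n) (hp : ∀ l, p l (π l)) :
    ∃ g : ι → ℕ, Function.Injective g ∧ ∀ l, g l < n ∧ p l (g l) ∧ Nat.count (p l) (g l) < k := by
  classical
  -- Hall's condition for a set `s`: either some `l ∈ s` has `k` candidates, which is at least the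
  -- size of `s`, or every candidate of each `l ∈ s` is among its first `k`, and `π` maps `s`
  -- injectively into their union.
  obtain ⟨g, hg, hg'⟩ := (all_card_le_biUnion_card_iff_exists_injective
    fun l => (range n).filter fun i => p l i ∧ Nat.count (p l) i < k).mp fun s => by
    by_cases h : ∃ l ∈ s, k ≤ Nat.count (p l) n
    · obtain ⟨l, hl, hk⟩ := h
      calc s.card ≤ k := (card_le_univ s).trans hι
        _ = ((range n).filter fun i => p l i ∧ Nat.count (p l) i < k).card := by
          rw [card_filter_count_lt, min_eq_left hk]
        _ ≤ _ := card_le_card (subset_biUnion_of_mem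
          (fun l => (range n).filter fun i => p l i ∧ Nat.count (p l) i < k) hl)
    · push Not at h
      rw [← card_image_of_injective s hπ]
      refine card_le_card fun i hi => ?_
      obtain ⟨l, hl, rfl⟩ := mem_image.mp hi
      exact mem_biUnion.mpr ⟨l, hl, mem_filter.mpr ⟨mem_range.mpr (hn l), hp l,
        (Nat.count_monotone _ (hn l).le).trans_lt (h l hl)⟩⟩
  refine ⟨g, hg, fun l => ?_⟩
  obtain ⟨h1, h2⟩ := mem_filter.mp (hg' l)
  exact ⟨mem_range.mp h1, h2⟩

/-- Completeness of the search. Items of positive value to their owner stay; each group of worthless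
items moves as a whole to an agent of small rank, chosen by Hall's theorem. The result `g` may
differ from `f`. -/
theorem NoEnvy.exists_decodes (hf : NoEnvy n k W U f) (hfn : ∀ a < k, 1 ≤ f a ∧ f a ≤ n)
    (hA : IsSpecialList n k W U S A) :
    ∃ d, (∀ a < k, d a < S + k + k) ∧ ∃ g, Decodes n k S W U A d g ∧ NoEnvy n k W U g := by
  classical
  obtain ⟨π, hπ⟩ : ∃ π : ℕ → ℕ, ∀ a < k, f a = π a + 1 :=
    ⟨fun a => f a - 1, fun a ha => (Nat.sub_add_cancel (hfn a ha).1).symm⟩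
  have hπn : ∀ a < k, π a < n := fun a ha => by
    have h1 := hπ a ha
    have h2 := (hfn a ha).2
    omega
  -- The items that are worthless to their owner.
  let Z : ℕ → Prop := fun a => a < k ∧ U (π a) a = 0
  -- `ρ` selects, for each owner of worthless items, one of them as the leader of her group; `L` is
  -- the set of leaders.
  obtain ⟨ρ, hρ⟩ : ∃ ρ : ℕ → ℕ, ∀ a, Z a → Z (ρ (π a)) ∧ π (ρ (π a)) = π a :=
    ⟨fun i => Classical.epsilon fun a => Z a ∧ π a = i, fun a ha =>
      Classical.epsilon_spec (p := fun b => Z b ∧ π b = π a) ⟨a, ha, rfl⟩⟩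
  let L := (range k).filter fun l => Z l ∧ ρ (π l) = l
  have hL : ∀ {l}, l ∈ L ↔ Z l ∧ ρ (π l) = l := fun {l} =>
    mem_filter.trans ⟨fun h => h.2, fun h => ⟨mem_range.mpr h.1.1, h⟩⟩
  have hρL : ∀ a, Z a → ρ (π a) ∈ L := fun a ha =>
    hL.mpr ⟨(hρ a ha).1, by rw [(hρ a ha).2]⟩
  have hleader : ∀ l ∈ L, ∀ a, Z a → (ρ (π a) = l ↔ π a = π l) := fun l hl a ha =>
    ⟨fun h => by rw [← h, (hρ a ha).2], fun h => by rw [h, (hL.mp hl).2]⟩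
  -- `X` gives the bundle values without the worthless items, and `v l` the values of the group led
  -- by `l`.
  let X : ℕ → ℕ → ℕ := fun j i => W j i + ∑ a ∈ range k, if ¬ Z a ∧ π a = i then U j a else 0
  let v : ℕ → ℕ → ℕ := fun l j => ∑ a ∈ range k, if Z a ∧ ρ (π a) = l then U j a else 0
  have hXle : ∀ j i, X j i ≤ extend W U k f j i := fun j i => by
    refine add_le_add_right (sum_le_sum fun a ha => ?_) _
    have := hπ a (mem_range.mp ha)
    split_ifs <;> omega
  have hXeq : ∀ j, extend W U k f j j = X j j := fun j => by
    refine congrArg (W j j + ·) (sum_congr rfl fun a ha => ?_)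
    have ha := mem_range.mp ha
    have h1 := hπ a ha
    by_cases h2 : π a = j
    · by_cases h3 : Z a
      · have h4 : U j a = 0 := h2 ▸ h3.2
        simp [h4]
      · simp [h1, h2, h3]
    · simp [h1, h2]
  have hXv : ∀ l ∈ L, ∀ j, X j (π l) + v l j = extend W U k f j (π l) := fun l hl j => by
    simp only [X, v, extend, add_assoc, ← sum_add_distrib]
    refine congrArg (W j (π l) + ·) (sum_congr rfl fun a ha => ?_)
    have h1 := hπ a (mem_range.mp ha)
    by_cases h3 : Z a
    · simp [h1, h3, hleader l hl a h3]
    · simp [h1, h3]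
  have hXX : ∀ j < n, ∀ i < n, X j i ≤ X j j := fun j hj i hi =>
    (hXle j i).trans ((hf j hj i hi).trans (hXeq j).le)
  -- The present owners show that distinct feasible agents exist: returning a group to its owner
  -- restores her bundle under `f`, while `X j j` is what `j` has under `f`.
  obtain ⟨g, hg, hg'⟩ := exists_injective_count_lt (n := n) (k := k) (ι := L)
    (by rw [Fintype.card_coe]; exact (card_filter_le _ _).trans (card_range k).le)
    (fun l => Feasible n X (v l)) (π := fun l => π l)
    (fun l l' h => Subtype.ext (by
      rw [← (hL.mp l.2).2, ← (hL.mp l'.2).2]; exact congrArg ρ h))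
    (fun l => hπn l (hL.mp l.2).1.1)
    (fun l j hj => by
      rw [hXv l l.2, ← hXeq j]
      exact hf j hj _ (hπn l (hL.mp l.2).1.1))
  obtain ⟨G, hG⟩ : ∃ G : ℕ → ℕ, ∀ l (h : l ∈ L), G l = g ⟨l, h⟩ :=
    ⟨fun l => if h : l ∈ L then g ⟨l, h⟩ else 0, fun l h => by simp [h]⟩
  have hGinj : ∀ l ∈ L, ∀ l' ∈ L, G l = G l' → l = l' := fun l hl l' hl' h => by
    rw [hG l hl, hG l' hl'] at h
    exact congrArg Subtype.val (hg h)
  have hG' : ∀ l ∈ L, G l < n ∧ Feasible n X (v l) (G l) ∧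
      Nat.count (Feasible n X (v l)) (G l) < k := fun l hl => by
    rw [hG l hl]; exact hg' ⟨l, hl⟩
  have hspec : ∀ a < k, ¬ Z a → ∃ x < S, A x = π a := fun a ha hz =>
    hA.mem _ (hπn a ha) (hf.special ha (hπn a ha) (hπ a ha)
      (Nat.pos_of_ne_zero fun h => hz ⟨ha, h⟩))
  obtain ⟨σ, hσ⟩ : ∃ σ : ℕ → ℕ, ∀ a < k, ¬ Z a → σ a < S ∧ A (σ a) = π a :=
    ⟨fun a => Classical.epsilon fun x => x < S ∧ A x = π a, fun a ha hz =>
      Classical.epsilon_spec (p := fun x => x < S ∧ A x = π a) (hspec a ha hz)⟩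
  let d : ℕ → ℕ := fun a => if Z a then
    if ρ (π a) = a then S + Nat.count (Feasible n X (v a)) (G a) else S + k + ρ (π a) else σ a
  have hd1 : ∀ a < k, ¬ Z a → d a = σ a := fun a _ hz => by simp [d, hz]
  have hd2 : ∀ l ∈ L, d l = S + Nat.count (Feasible n X (v l)) (G l) := fun l hl => by
    simp [d, hL.mp hl]
  have hd3 : ∀ a, Z a → ρ (π a) ≠ a → d a = S + k + ρ (π a) := fun a hz h => by simp [d, hz, h]
  have hfirst : extend W U k (firstAlloc S A d) = X := by
    funext j i
    refine congrArg (W j i + ·) (sum_congr rfl fun a ha => ?_)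
    have ha := mem_range.mp ha
    by_cases hz : Z a
    · have : ¬ d a < S := by
        by_cases h : ρ (π a) = a
        · have := hd2 a (hL.mpr ⟨hz, h⟩); omega
        · have := hd3 a hz h; omega
      simp [firstAlloc, this, hz]
    · have h1 := hσ a ha hz
      simp [firstAlloc, hd1 a ha hz, h1, hz]
  have hjoin : ∀ l ∈ L, joined U k (S + k) d l = v l := by
    intro l hl
    funext j
    have h1 : U j l = ∑ a ∈ range k, if a = l then U j a else 0 := by
      rw [sum_ite_eq' (range k) l, if_pos (mem_range.mpr (hL.mp hl).1.1)]
    rw [joined, h1, ← sum_add_distrib]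
    refine sum_congr rfl fun a ha => ?_
    have ha := mem_range.mp ha
    by_cases hz : Z a
    · by_cases h : ρ (π a) = a
      · have hlt := (hG' a (hL.mpr ⟨hz, h⟩)).2.2
        have := hd2 a (hL.mpr ⟨hz, h⟩)
        -- A leader has a digit below `S + k` and so points nowhere; it contributes to its own group
        -- by the separate summand `U j l` of `joined`.
        rw [if_neg (show ¬ d a = S + k + l by omega)]
        simp [hz, h]
      · have h2 : a ≠ l := by rintro rfl; exact h (hL.mp hl).2
        simp [hd3 a hz h, h2, hz]
    · have h1 := (hσ a ha hz).1
      have h2 : a ≠ l := by rintro rfl; exact hz (hL.mp hl).1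
      rw [if_neg h2, if_neg (by rw [hd1 a ha hz]; omega), if_neg fun h => hz h.1]
  let F : ℕ → ℕ := fun a => if Z a then G (ρ (π a)) + 1 else π a + 1
  refine ⟨d, fun a ha => ?_, F, fun a ha => ?_, fun j hj i hi => ?_⟩
  · by_cases hz : Z a
    · by_cases h : ρ (π a) = a
      · have hlt := (hG' a (hL.mpr ⟨hz, h⟩)).2.2
        have := hd2 a (hL.mpr ⟨hz, h⟩)
        omega
      · have h1 := hd3 a hz h
        have h2 := (hρ a hz).1.1
        omega
    · have h1 := hσ a ha hz
      have h2 := hd1 a ha hz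
      omega
  · rw [hfirst]
    by_cases hz : Z a
    · by_cases h : ρ (π a) = a
      · have hl := hL.mpr ⟨hz, h⟩
        obtain ⟨h1, h2, h3⟩ := hG' a hl
        have h4 := hd2 a hl
        refine Or.inr (Or.inl ⟨by omega, by omega, G a, h1, by simp [F, hz, h], ?_⟩)
        rw [hjoin a hl]
        exact ⟨h2, h4.symm⟩
      · have hl := hρL a hz
        have hl' := hL.mp hl
        have h3 := (hG' _ hl).2.2
        have h4 := hd2 _ hl
        refine Or.inr (Or.inr ⟨ρ (π a), hl'.1.1, hd3 a hz h, by omega, ?_⟩)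
        simp [F, hz, hl'.1, hl'.2]
    · have h1 := hσ a ha hz
      have h2 := hd1 a ha hz
      exact Or.inl ⟨by omega, by simp [F, hz, h1, h2]⟩
  · have hup : X j j ≤ extend W U k F j j := by
      refine add_le_add_right (sum_le_sum fun a _ => ?_) _
      by_cases hz : Z a
      · simp [hz]
      · simp [hz, F]
    refine le_trans ?_ hup
    -- As `G` is injective on leaders, `i` receives either exactly one group, for which she is
    -- feasible, or none, and then `X j i ≤ X j j` suffices.
    by_cases hl : ∃ l ∈ L, G l = i
    · obtain ⟨l, hl, rfl⟩ := hl
      refine le_trans (le_of_eq ?_) ((hG' l hl).2.1 j hj)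
      simp only [X, v, extend, add_assoc, ← sum_add_distrib]
      refine congrArg (W j (G l) + ·) (sum_congr rfl fun a _ => ?_)
      by_cases hz : Z a
      · have : G (ρ (π a)) = G l ↔ ρ (π a) = l :=
          ⟨hGinj _ (hρL a hz) l hl, fun h => by rw [h]⟩
        simp [F, hz, this]
      · simp [F, hz]
    · refine le_trans (le_of_eq ?_) (hXX j hj i hi)
      refine congrArg (W j i + ·) (sum_congr rfl fun a _ => ?_)
      by_cases hz : Z a
      · have : G (ρ (π a)) ≠ i := fun h => hl ⟨_, hρL a hz, h⟩
        simp [F, hz, this]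
      · simp [F, hz]

end EnvySearch

/-! ### Reading the input, and the complete program for instances with agents and items -/

namespace EnvySearch

open RAM Finset

variable {n m k : ℕ} {g : ℕ → ℕ} {V W U : ℕ → ℕ → ℕ} {s s' : State} {p : Prog}

/-- Array `0` holds `n` and `m`, the owners `g` of `m` items, and the values `V` of the items for `n`
agents; registers `1` and `2` hold `n` and `m`. -/
structure Input (n m : ℕ) (g : ℕ → ℕ) (V : ℕ → ℕ → ℕ) (s : State) : Prop where
  n_eq : s.reg 1 = n
  m_eq : s.reg 2 = m
  owner : ∀ a < m, s.arr 0 (2 + a) = g a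
  owner_le : ∀ a < m, g a ≤ n
  val : ∀ i < n, ∀ a < m, s.arr 0 (2 + (m + (i * m + a))) = V i a

theorem Input.agree (h : Input n m g V s) (ha : Agree p s s')
    (hp : 1 ∉ p.wr ∧ 2 ∉ p.wr ∧ 0 ∉ p.wa) : Input n m g V s' where
  n_eq := (ha.reg _ hp.1).trans h.n_eq
  m_eq := (ha.reg _ hp.2.1).trans h.m_eq
  owner := by rw [ha.arr _ hp.2.2]; exact h.owner
  owner_le := h.owner_le
  val := by rw [ha.arr _ hp.2.2]; exact h.val

/-- Count in register `3` the open items. -/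
def countOpen : Prog :=
  .seq (.assign 3 (.const 0)) (forUp 10 2 (.ite (.read 0 (.add (.const 2) (.reg 10))) .nop
    (.assign 3 (.add (.reg 3) (.const 1)))))

theorem runs_countOpen (hs : Input n m g V s) :
    Runs countOpen s (m * 20 + 10) fun s' => s'.reg 3 = Nat.count (fun a => g a = 0) m := by
  refine (Runs.seq (Runs.assign ?_)).mono (T := 2 + (m * (12 + 8) + 6)) (by omega)
  have hs₀ : Input n m g V (s.setReg 3 ((Expr.const 0).eval s)) :=
    hs.agree (Exec.agree (.assign s 3 (.const 0))) (by decide)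
  refine Runs.forUp (fun a s' => s'.reg 3 = Nat.count (fun a => g a = 0) a) hs₀.m_eq
    (by decide) (by decide) (by decide) (by simp [Expr.eval]) fun a ham s₁ hr₁ ha₁ hI₁ => ?_
  have hs₁ := hs₀.agree ha₁ (by decide)
  have hb : (Expr.read 0 (.add (.const 2) (.reg 10))).eval s₁ = g a := by
    simp [Expr.eval, hr₁, hs₁.owner a ham]
  refine (Runs.ite (T₁ := 1) (T₂ := 4) (fun h => ?_) (fun h => ?_)).mono (by simp [Expr.cost])
  · rw [hb] at h
    exact Runs.nop (by simp [hI₁, Nat.count_succ, h])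
  · rw [hb] at h
    exact Runs.assign (by simp [Expr.eval, hI₁, Nat.count_succ, h])

/-- Write the multiples of `n` into array `4`, and the multiples of `m` into array `9`. -/
def tabulate : Prog :=
  .seq (.assign 7 (.add (.reg 1) (.reg 3))) (.seq (.assign 24 (.const 0)) (.seq
    (.assign 25 (.const 0)) (forUp 10 7 (.seq (.store 4 (.reg 10) (.reg 24))
      (.seq (.store 9 (.reg 10) (.reg 25)) (.seq (.assign 24 (.add (.reg 24) (.reg 1)))
        (.assign 25 (.add (.reg 25) (.reg 2)))))))))

/-- The machine cannot multiply, so the row offsets of all matrices are tabulated by repeated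
addition; `n + k` rows are enough for both the bundle and the item values. -/
theorem runs_tabulate (hs : Input n m g V s) (hk : s.reg 3 = k) :
    Runs tabulate s ((n + k) * 30 + 20) fun s' =>
      (∀ i < n + k, s'.arr 4 i = i * n) ∧ ∀ i < n + k, s'.arr 9 i = i * m := by
  refine (Runs.seq (Runs.assign (Runs.seq (Runs.assign (Runs.seq (Runs.assign
    ?_)))))).mono (T := 4 + (2 + (2 + ((n + k) * (14 + 8) + 6)))) (by omega)
  set s₀ := ((s.setReg 7 _).setReg 24 _).setReg 25 _ with hs₀'
  have hs₀ : Input n m g V s₀ :=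
    hs.agree (Exec.agree (.seq (.assign s 7 (.add (.reg 1) (.reg 3)))
      (.seq (.assign _ 24 (.const 0)) (.assign _ 25 (.const 0))))) (by decide)
  have h7 : s₀.reg 7 = n + k := by simp [s₀, Expr.eval, hs.n_eq, hk]
  refine (Runs.forUp (fun i s' => s'.reg 24 = i * n ∧ s'.reg 25 = i * m ∧
    (∀ i' < i, s'.arr 4 i' = i' * n) ∧ ∀ i' < i, s'.arr 9 i' = i' * m) h7
    (by decide) (by decide) (by decide) (by simp [s₀, Expr.eval])
    fun i hi s₁ hr₁ ha₁ hI₁ => ?_).weaken le_rfl fun s' _ h => h.2.2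
  have hs₁ := hs₀.agree ha₁ (by decide)
  obtain ⟨c1, c2, c3, c4⟩ := hI₁
  refine (Runs.seq (Runs.store (Runs.seq (Runs.store (Runs.seq (Runs.assign
    (Runs.assign ?_))))))).mono (by simp [Expr.cost])
  refine ⟨?_, ?_, fun i' hi' => ?_, fun i' hi' => ?_⟩
  · simp [Expr.eval, c1, hs₁.n_eq, Nat.succ_mul]
  · simp [Expr.eval, c2, hs₁.m_eq, Nat.succ_mul]
  · simp only [State.setReg_arr, State.setArr_arr, Expr.eval, hr₁, c1, true_and]
    rcases Nat.lt_succ_iff_lt_or_eq.mp hi' with h' | rfl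
    · simp [h'.ne, c3 i' h']
    · simp
  · simp only [State.setReg_arr, State.setArr_arr, State.setArr_reg, Expr.eval, hr₁, c2, true_and]
    rcases Nat.lt_succ_iff_lt_or_eq.mp hi' with h' | rfl
    · simp [h'.ne, c4 i' h']
    · simp

/-- The value for `i` of those among the first `m` items that belong to `j`. -/
def givenValue (g : ℕ → ℕ) (V : ℕ → ℕ → ℕ) (m i j : ℕ) : ℕ :=
  ∑ a ∈ range m, if g a = j + 1 then V i a else 0

/-- The value for `i` of the `c`-th open item. -/
noncomputable def openValue (g : ℕ → ℕ) (V : ℕ → ℕ → ℕ) (i c : ℕ) : ℕ := V i (Nat.nth (fun a => g a = 0) c)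

/-- The value of the item given by register `11` for the agent given by register `10`. -/
abbrev valueExpr : Expr :=
  .read 0 (.add (.const 2) (.add (.reg 2) (.add (.read 9 (.reg 10)) (.reg 11))))

/-- The owner of the item given by register `11`. -/
abbrev ownerExpr : Expr := .read 0 (.add (.const 2) (.reg 11))

/-- Compute in array `1` the values of the given bundles, and in array `2` those of the open
items. -/
def load : Prog :=
  forUp 10 1 (.seq (.assign 26 (.const 0)) (forUp 11 2 (.ite ownerExpr
    (.store 1 (.add (.read 4 (.reg 10)) (.sub ownerExpr (.const 1)))
      (.add (.read 1 (.add (.read 4 (.reg 10)) (.sub ownerExpr (.const 1)))) valueExpr))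
    (.seq (.store 2 (.add (.read 4 (.reg 26)) (.reg 10)) valueExpr)
      (.assign 26 (.add (.reg 26) (.const 1)))))))

/-- Bundle values are accumulated, so array `1` has to start at zero. Register `26` counts the open
items already passed and thereby numbers the open items by rank. -/
theorem runs_load (hs : Input n m g V s) (hk : k = Nat.count (fun a => g a = 0) m)
    (h4 : ∀ i < n + k, s.arr 4 i = i * n) (h9 : ∀ i < n + k, s.arr 9 i = i * m)
    (h1 : ∀ x, s.arr 1 x = 0) :
    Runs load s (n * (m * 80 + 30) + 6) fun s' =>
      (∀ i < n, ∀ j < n, s'.arr 1 (i * n + j) = givenValue g V m i j) ∧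
      ∀ c < k, ∀ i < n, s'.arr 2 (c * n + i) = openValue g V i c := by
  refine (Runs.forUp (T := 2 + (m * (70 + 8) + 6)) (fun i s' =>
    (∀ i' < n, ∀ j < n, s'.arr 1 (i' * n + j) = givenValue g V (if i' < i then m else 0) i' j) ∧
    ∀ c < k, ∀ i' < i, s'.arr 2 (c * n + i') = openValue g V i' c) hs.n_eq
    (by decide) (by decide) (by decide) (by simp [h1, givenValue])
    fun i hi s₁ hr₁ ha₁ hI₁ => ?_).weaken
    (Nat.add_le_add_right (Nat.mul_le_mul_left _ (by omega)) _) fun s' _ h =>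
      ⟨fun i hi j hj => by simpa [hi] using h.1 i hi j hj, h.2⟩
  have hs₁ := hs.agree ha₁ (by decide)
  refine Runs.seq (Runs.assign ?_)
  set s₁' := s₁.setReg 26 ((Expr.const 0).eval s₁) with hs₁'
  have hs₂ : Input n m g V s₁' := hs₁.agree (Exec.agree (.assign s₁ 26 (.const 0))) (by decide)
  have g10 : s₁'.reg 10 = i := hr₁
  have g4 : s₁'.arr 4 = s.arr 4 := ha₁.arr 4 (by decide)
  have g9 : s₁'.arr 9 = s.arr 9 := ha₁.arr 9 (by decide)
  refine (Runs.forUp (fun a s' => s'.reg 26 = Nat.count (fun a => g a = 0) a ∧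
    (∀ i' < n, ∀ j < n, s'.arr 1 (i' * n + j) =
      givenValue g V (if i' < i then m else if i' = i then a else 0) i' j) ∧
    -- For the current agent only the open items already passed have been stored.
    ∀ c < k, ∀ i' ≤ i, (i' = i → c < Nat.count (fun a => g a = 0) a) →
      s'.arr 2 (c * n + i') = openValue g V i' c) hs₂.m_eq
    (by decide) (by decide) (by decide) ⟨by simp [s₁', Expr.eval], fun i' hi' j hj => ?_,
      fun c hc i' hi' h => ?_⟩ fun a ham s₃ hr₃ ha₃ hI₃ => ?_).weaken le_rfl fun s₄ _ h => ?_
  · simpa [s₁'] using hI₁.1 i' hi' j hj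
  · have hlt : i' < i := by
      rcases hi'.lt_or_eq with h' | h'
      exacts [h', absurd (h h') (by simp)]
    simpa [s₁'] using hI₁.2 c hc i' hlt
  · have hs₃ := hs₂.agree ha₃ (by decide)
    have f10 : s₃.reg 10 = i := (ha₃.reg _ (by decide)).trans g10
    have f4 : s₃.arr 4 = s.arr 4 := (ha₃.arr _ (by decide)).trans g4
    have f9 : s₃.arr 9 = s.arr 9 := (ha₃.arr _ (by decide)).trans g9
    have hown : ownerExpr.eval s₃ = g a := by simp [Expr.eval, hr₃, hs₃.owner a ham]
    have hval : valueExpr.eval s₃ = V i a := by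
      simp [Expr.eval, hr₃, hs₃.m_eq, f10, f9, h9 i (by omega), hs₃.val i hi a ham]
    have hrow : (Expr.read 4 (.reg 10)).eval s₃ = i * n := by
      simp [Expr.eval, f10, f4, h4 i (by omega)]
    obtain ⟨c1, c2, c3⟩ := hI₃
    refine (Runs.ite (T₁ := 30) (T₂ := 20) (fun hb => ?_) (fun hb => ?_)).mono
      (by simp [Expr.cost])
    · rw [hown] at hb
      have hle := hs.owner_le a ham
      have hja : g a - 1 < n := by omega
      refine (Runs.store ⟨?_, fun i' hi' j hj => ?_, fun c hc i' hi' h => ?_⟩).mono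
        (by simp [Expr.cost])
      · simp [c1, Nat.count_succ, hb]
      · have hc2 := c2 i hi _ hja
        rw [if_neg (lt_irrefl i), if_pos rfl] at hc2
        have e1 : (Expr.add (.read 4 (.reg 10)) (.sub ownerExpr (.const 1))).eval s₃ =
            i * n + (g a - 1) := by
          rw [Expr.eval, hrow, Expr.eval, hown, Expr.eval]
        have e2 : (Expr.add (.read 1 (.add (.read 4 (.reg 10)) (.sub ownerExpr (.const 1))))
            valueExpr).eval s₃ = givenValue g V a i (g a - 1) + V i a := by
          rw [Expr.eval, Expr.eval, e1, hval, hc2]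
        rw [e1, e2]
        simp only [State.setReg_arr, State.setArr_arr, true_and, mul_add_inj hj hja, c2 i' hi' j hj]
        by_cases h1 : i' = i
        · subst h1
          simp only [true_and, lt_irrefl, if_false, if_true]
          by_cases h2 : j = g a - 1
          · have h3 : g a = g a - 1 + 1 := by omega
            rw [if_pos h2, h2, givenValue, givenValue, sum_range_succ, if_pos h3]
          · rw [if_neg h2, givenValue, givenValue, sum_range_succ,
              if_neg (show ¬ g a = j + 1 by omega), add_zero]
        · simp [h1]
      · rw [Nat.count_succ, if_neg hb, add_zero] at h
        simpa using c3 c hc i' hi' h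
    · rw [hown] at hb
      have hck : Nat.count (fun a => g a = 0) a < k := by
        rw [hk]
        have := Nat.count_monotone (fun a => g a = 0) (show a + 1 ≤ m from ham)
        rw [Nat.count_succ, if_pos hb] at this
        omega
      refine (Runs.seq (Runs.store (Runs.assign ⟨?_, fun i' hi' j hj => ?_,
        fun c hc i' hi' h => ?_⟩))).mono (by simp [Expr.cost])
      · simp [Expr.eval, c1, Nat.count_succ, hb]
      · simp only [State.setReg_arr, State.setArr_arr]
        rw [if_neg (by omega), c2 i' hi' j hj]
        by_cases h1 : i' = i
        · subst h1
          simp [givenValue, sum_range_succ, hb]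
        · simp [h1]
      · have e1 : (Expr.add (.read 4 (.reg 26)) (.reg 10)).eval s₃ =
            Nat.count (fun a => g a = 0) a * n + i := by
          simp [Expr.eval, c1, f4, f10, h4 _ (show Nat.count (fun a => g a = 0) a < n + k by omega)]
        rw [e1, hval]
        simp only [State.setReg_arr, State.setArr_arr, true_and,
          mul_add_inj (show i' < n by omega) hi]
        split_ifs with h1
        · rw [h1.1, h1.2, openValue, Nat.nth_count (p := fun a => g a = 0) hb]
        · refine c3 c hc i' hi' fun h2 => ?_
          have := h h2
          rw [Nat.count_succ, if_pos hb] at this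
          omega
  · refine ⟨fun i' hi' j hj => ?_, fun c hc i' hi' => ?_⟩
    · simp only [State.setReg_arr, h.2.1 i' hi' j hj]
      rcases lt_trichotomy i' i with h1 | h1 | h1
      · rw [if_pos h1, if_pos (by omega)]
      · rw [if_neg (by omega), if_pos h1, if_pos (by omega)]
      · rw [if_neg (by omega), if_neg (by omega), if_neg (by omega)]
    · exact h.2.2 c hc i' (by omega) fun _ => hk ▸ hc

/-- Solve an instance with at least one agent and one item. -/
def solveNonempty : Prog :=
  .seq countOpen (.seq tabulate (.seq load (.seq countEnvious (.ite (.lt (.reg 3) (.reg 8))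
    (.assign 0 (.const 0))
    (.seq listSpecial (.seq (.assign 5 (.add (.reg 4) (.reg 3)))
      (.seq (.assign 6 (.add (.reg 5) (.reg 3))) (.seq enumerate (.assign 0 (.reg 9))))))))))

/-- The bound `B` on the number of candidates is available only if at most `k` agents are envious;
this is why the program tests that before it searches. -/
theorem runs_solveNonempty (hs : Input n m g V s) (hn : 0 < n)
    (hk : k = Nat.count (fun a => g a = 0) m) (h1 : ∀ x, s.arr 1 x = 0) (h6 : ∀ x, s.arr 6 x = 0)
    (hW : W = givenValue g V m) (hU : U = openValue g V) {B : ℕ} (hB : 1 ≤ B)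
    (hSB : Nat.count (Envious n W) n ≤ k → (Nat.count (Special n k W U) n + k + k) ^ k ≤ B) :
    Runs solveNonempty s (1000 * (B * ((k + 1) ^ 2 * (n + 1) ^ 2) + (n + 1) * (m + 1))) fun s' =>
      Flag (s'.reg 0) (∃ f : ℕ → ℕ, (∀ a < k, 1 ≤ f a ∧ f a ≤ n) ∧ NoEnvy n k W U f) := by
  have hkm : k ≤ m := hk ▸ Nat.count_le _
  have hT : (m * 20 + 10) + (((n + k) * 30 + 20) + ((n * (m * 80 + 30) + 6) +
      ((n * (n * 30 + 30) + 20) + (10 + (2 + ((n * (k * (n * 40 + 40) + 40) + 20) +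
        (4 + (4 + ((B * (600 * ((k + 1) ^ 2 * (n + 1) ^ 2)) + 20) + 2)))))))))
      ≤ 1000 * (B * ((k + 1) ^ 2 * (n + 1) ^ 2) + (n + 1) * (m + 1)) := by
    have e : (k + 1) ^ 2 * (n + 1) ^ 2 ≤ B * ((k + 1) ^ 2 * (n + 1) ^ 2) :=
      Nat.le_mul_of_pos_left _ hB
    have e1 : n * n + n * n * k + n * k + 1 ≤ (k + 1) ^ 2 * (n + 1) ^ 2 := by
      have : (k + 1) ^ 2 * (n + 1) ^ 2 = n * n + n * n * k + n * k + 1 + (n * n * k + 3 * (n * k) +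
        2 * n + 2 * k + k * k * (n + 1) ^ 2) := by ring
      omega
    have e2 : (n + 1) * (m + 1) = n * m + n + m + 1 := by ring
    have e3 : n * (k * (n * 40 + 40) + 40) = 40 * (n * n * k) + 40 * (n * k) + 40 * n := by ring
    have e4 : n * (m * 80 + 30) = 80 * (n * m) + 30 * n := by ring
    have e5 : n * (n * 30 + 30) = 30 * (n * n) + 30 * n := by ring
    have e6 : B * (600 * ((k + 1) ^ 2 * (n + 1) ^ 2)) =
      600 * (B * ((k + 1) ^ 2 * (n + 1) ^ 2)) := by ring
    rw [e2, e3, e4, e5, e6]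
    omega
  refine Runs.mono (Runs.seq ((runs_countOpen hs).weaken le_rfl fun s₁ ha₁ hk₁ => ?_)) hT
  rw [← hk] at hk₁
  have hs₁ := hs.agree ha₁ (by decide)
  refine Runs.seq ((runs_tabulate hs₁ hk₁).weaken le_rfl fun s₂ ha₂ h₂ => ?_)
  have hs₂ := hs₁.agree ha₂ (by decide)
  refine Runs.seq ((runs_load hs₂ hk h₂.1 h₂.2 fun x => ?_).weaken le_rfl fun s₃ ha₃ h₃ => ?_)
  · rw [ha₂.arr 1 (by decide), ha₁.arr 1 (by decide), h1]
  have hs₃ := hs₂.agree ha₃ (by decide)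
  have he : Env n k W U s₃ :=
    ⟨hs₃.n_eq, by rw [ha₃.reg 3 (by decide), ha₂.reg 3 (by decide), hk₁],
      by rw [ha₃.arr 4 (by decide)]; exact h₂.1, hW ▸ h₃.1, hU ▸ h₃.2⟩
  refine Runs.seq ((runs_countEnvious he).weaken le_rfl fun s₄ ha₄ h₄ => ?_)
  have he₄ := he.agree ha₄ (by decide)
  have hb : (Expr.lt (.reg 3) (.reg 8)).eval s₄ =
      if k < Nat.count (Envious n W) n then 1 else 0 := by
    simp only [Expr.eval, he₄.k_eq, h₄]
  refine (Runs.ite (T₁ := 2) (T₂ := n * (k * (n * 40 + 40) + 40) + 20 +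
    (4 + (4 + ((B * (600 * ((k + 1) ^ 2 * (n + 1) ^ 2)) + 20) + 2)))) (fun h => ?_)
    (fun h => ?_)).mono (by simp only [Expr.cost]; omega)
  · have hlt : k < Nat.count (Envious n W) n := by
      by_contra hlt; simp [hb, hlt] at h
    refine Runs.assign ⟨fun ⟨f, _, hf⟩ => ?_, fun _ => by simp [Expr.eval]⟩
    have := hf.count_envious_le
    omega
  have hle : Nat.count (Envious n W) n ≤ k := by
    by_contra hlt; simp [hb] at h; omega
  refine Runs.seq ((runs_listSpecial he₄).weaken le_rfl fun s₅ ha₅ h₅ => ?_)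
  have he₅ := he₄.agree ha₅ (by decide)
  refine Runs.seq (Runs.assign (Runs.seq (Runs.assign ?_)))
  set s₆ := (s₅.setReg 5 _).setReg 6 _ with hs₆'
  have ha₆ : Agree (.seq (.assign 5 (.add (.reg 4) (.reg 3))) (.assign 6 (.add (.reg 5) (.reg 3))))
    s₅ s₆ := Exec.agree (.seq (.assign _ _ _) (.assign _ _ _))
  have hs₆ : SearchEnv n k (s₅.reg 4) W U (s₅.arr 7) s₆ :=
    { he₅.agree ha₆ (by decide) with
      n_pos := hn
      S_eq := ha₆.reg _ (by decide)
      Sk_eq := by simp [s₆, Expr.eval, he₅.k_eq]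
      base_eq := by simp [s₆, Expr.eval, he₅.k_eq]
      arr_eq := ha₆.arr _ (by decide)
      arr_lt := h₅.lt }
  refine Runs.seq ((runs_enumerate hs₆ fun a _ => ?_).weaken ?_ fun s₇ _ h₇ => ?_)
  · rw [ha₆.arr 6 (by decide), ha₅.arr 6 (by decide), ha₄.arr 6 (by decide), ha₃.arr 6 (by decide),
      ha₂.arr 6 (by decide), ha₁.arr 6 (by decide), h6]
  · rw [h₅.card]
    exact Nat.add_le_add_right (Nat.mul_le_mul_right _ (hSB hle)) _
  refine Runs.assign ⟨fun ⟨f, hf, hf'⟩ => ?_, fun hno => ?_⟩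
  · obtain ⟨d, hd, e, hde, he⟩ := hf'.exists_decodes hf h₅
    simpa [Expr.eval] using h₇.2.2 d hd e hde he
  · have : s₇.reg 9 ≠ 1 := fun h => hno (h₇.2.1 h)
    have := h₇.1
    simp only [State.setReg_reg, if_true, Expr.eval]
    omega

end EnvySearch

/-! ### The computable parameter function, and the length against the binary size -/

namespace RAM

/-- For `κ = k + n_t` one has `k * n_t ≤ κ * κ`. The `+ 1` makes the base positive, so that the
exponent may grow from `C * k` to `C * κ`, and the factor `2` absorbs the additive term for the
input length. -/
theorem computable_fpt_bound (C : ℕ) : Computable fun κ : ℕ => 2 * C * (κ * κ + 1) ^ (C * κ) := by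
  have hpow : Primrec₂ fun a b : ℕ => a ^ b := Primrec₂.unpaired'.1 Nat.Primrec.pow
  have hκ : Primrec fun κ : ℕ => κ * κ + 1 :=
    Primrec.succ.comp (Primrec.nat_mul.comp Primrec.id Primrec.id)
  have hC : Primrec fun κ : ℕ => C * κ := Primrec.nat_mul.comp (Primrec.const C) Primrec.id
  exact (Primrec.nat_mul.comp (Primrec.const (2 * C)) (hpow.comp hκ hC)).to_comp

theorem length_le_bitSize (w : List ℕ) : w.length ≤ bitSize w := by
  unfold bitSize
  induction w with
  | nil => simp
  | cons x w ih =>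
    simp only [List.length_cons, List.map_cons, List.sum_cons]
    omega

end RAM

/-! ### From encoded instances to matrices of values -/

namespace EnvySearch

open RAM Finset

/-- A sum over the elements of a decidable set, in increasing order. -/
theorem sum_range_count (p : ℕ → Prop) [DecidablePred p] (H : ℕ → ℕ → ℕ) (m : ℕ) :
    ∑ c ∈ range (Nat.count p m), H c (Nat.nth p c) =
      ∑ a ∈ range m, if p a then H (Nat.count p a) a else 0 := by
  induction m with
  | zero => simp
  | succ m ih =>
    rw [Nat.count_succ, sum_range_succ, ← ih]
    split_ifs with h
    · rw [sum_range_succ, Nat.nth_count h]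
    · simp

variable (I : AllocationInstance)

/-- The owner of an item, as in the encoding of an instance. -/
def owner (a : ℕ) : ℕ :=
  if h : a < I.m then (I.given ⟨a, h⟩).elim 0 fun j => j.val + 1 else 0

/-- The value of an item for an agent, given by their numbers. -/
def itemValue (i a : ℕ) : ℕ := if h : i < I.n ∧ a < I.m then I.val ⟨i, h.1⟩ ⟨a, h.2⟩ else 0

theorem owner_fin (a : Fin I.m) : owner I a = (I.given a).elim 0 fun j => j.val + 1 := by
  simp [owner]

theorem itemValue_fin (i : Fin I.n) (a : Fin I.m) : itemValue I i a = I.val i a := by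
  simp [itemValue]

theorem owner_eq_zero (a : Fin I.m) : owner I a = 0 ↔ I.given a = none := by
  rw [owner_fin]
  cases I.given a <;> simp

theorem owner_eq_succ (a : Fin I.m) (j : Fin I.n) : owner I a = j + 1 ↔ I.given a = some j := by
  rw [owner_fin]
  cases I.given a <;> simp [Fin.ext_iff]

theorem owner_le (a : ℕ) : owner I a ≤ I.n := by
  unfold owner
  split_ifs with h
  · cases I.given ⟨a, h⟩ with
    | none => simp
    | some j => simp
  · simp

theorem numOpen_eq : I.numOpen = Nat.count (fun a => owner I a = 0) I.m := by
  rw [AllocationInstance.numOpen, Fintype.card_subtype, Nat.count_eq_card_filter_range]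
  simp only [card_filter, ← owner_eq_zero I]
  exact Fin.sum_univ_eq_sum_range (fun a => if owner I a = 0 then 1 else 0) I.m

theorem length_encode : I.encode.length = 2 + I.m + I.n * I.m := by
  simp [AllocationInstance.encode, List.length_flatten, List.map_ofFn, Function.comp_def]
  omega

theorem encode_owner {a : ℕ} (ha : a < I.m) : I.encode.getD (2 + a) 0 = owner I a := by
  simp [AllocationInstance.encode, owner, ha, List.getD_eq_getElem?_getD,
    List.getElem?_append, Nat.add_comm 2 a]

theorem encode_val {i a : ℕ} (hi : i < I.n) (ha : a < I.m) :
    I.encode.getD (2 + (I.m + (i * I.m + a))) 0 = itemValue I i a := by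
  have hm : 0 < I.m := by omega
  have hdm : ∀ i' a' : ℕ, a' < I.m → (i' * I.m + a') / I.m = i' ∧ (i' * I.m + a') % I.m = a' :=
    fun i' a' h => by
      rw [Nat.mul_comm, Nat.mul_add_div hm, Nat.mul_add_mod, Nat.div_eq_of_lt h, Nat.mod_eq_of_lt h]
      simp
  have h1 : (List.ofFn fun i => List.ofFn (I.val i)).flatten =
      List.ofFn fun x : Fin (I.n * I.m) => itemValue I (x / I.m) (x % I.m) := by
    rw [List.ofFn_mul]
    congr 2
    funext i'
    congr 1
    funext a'
    obtain ⟨e1, e2⟩ := hdm i' a' a'.2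
    simp [e1, e2, itemValue]
  have hlt : i * I.m + a < I.n * I.m := by
    calc i * I.m + a < (i + 1) * I.m := by rw [Nat.succ_mul]; omega
      _ ≤ _ := Nat.mul_le_mul_right _ hi
  obtain ⟨e1, e2⟩ := hdm i a ha
  rw [AllocationInstance.encode, h1, List.getD_append_right _ _ _ _ (by simp; omega)]
  simp only [List.length_append, List.length_cons, List.length_nil, List.length_ofFn]
  rw [show 2 + (I.m + (i * I.m + a)) - (0 + 1 + 1 + I.m) = i * I.m + a by omega,
    List.getD_eq_getElem _ _ (by simpa using hlt), List.getElem_ofFn]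
  simp [e1, e2]

theorem input_encode {s : State} (h0 : s.arr 0 = (State.init I.encode).arr 0) (h1 : s.reg 1 = I.n)
    (h2 : s.reg 2 = I.m) : Input I.n I.m (owner I) (itemValue I) s where
  n_eq := h1
  m_eq := h2
  owner a ha := by rw [h0]; exact encode_owner I ha
  owner_le a _ := owner_le I a
  val i hi a ha := by rw [h0]; exact encode_val I hi ha

theorem mem_bundle (π : I.OpenItem → Fin I.n) (j : Fin I.n) (a : Fin I.m) :
    a ∈ I.bundle π j ↔ I.given a = some j ∨ ∃ h : I.given a = none, π ⟨a, h⟩ = j := by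
  simp only [AllocationInstance.bundle, AllocationInstance.givenBundle,
    AllocationInstance.openBundle, mem_union, mem_filter, mem_univ, true_and, mem_image]
  refine or_congr_right ⟨?_, fun ⟨h, h'⟩ => ⟨⟨a, h⟩, h', rfl⟩⟩
  rintro ⟨b, h, rfl⟩
  exact ⟨b.2, h⟩

/-- Open items are numbered by their rank, with `Nat.count` and `Nat.nth` as inverse passages;
`sum_range_count` turns the sum over numbers into one over items. -/
theorem value_bundle (π : I.OpenItem → Fin I.n) (f : ℕ → ℕ)
    (hf : ∀ a : I.OpenItem, f (Nat.count (fun a => owner I a = 0) a.1) = π a + 1)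
    (i j : Fin I.n) :
    I.value i (I.bundle π j) = extend (givenValue (owner I) (itemValue I) I.m)
      (openValue (owner I) (itemValue I)) I.numOpen f i j := by
  rw [extend, numOpen_eq]
  simp only [openValue, givenValue]
  rw [sum_range_count (fun a => owner I a = 0)
    (fun c a => if f c = j + 1 then itemValue I i a else 0), ← sum_add_distrib,
    ← Fin.sum_univ_eq_sum_range (fun a => (if owner I a = j + 1 then itemValue I i a else 0) +
      if owner I a = 0 then
        if f (Nat.count (fun a => owner I a = 0) a) = j + 1 then itemValue I i a else 0 else 0),
    AllocationInstance.value, ← sum_subset (subset_univ (I.bundle π j))]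
  · refine sum_congr rfl fun a ha => ?_
    rcases (mem_bundle I π j a).mp ha with h | ⟨h, h'⟩
    · rw [(owner_eq_succ I a j).mpr h, if_pos rfl, if_neg (by omega), itemValue_fin, add_zero]
    · rw [(owner_eq_zero I a).mpr h, if_neg (by omega), if_pos rfl, hf ⟨a, h⟩, h', if_pos rfl,
        itemValue_fin, zero_add]
  · intro a _ ha
    rw [mem_bundle, not_or] at ha
    rw [if_neg fun h => ha.1 ((owner_eq_succ I a j).mp h), zero_add]
    split_ifs with h1 h2
    · have h3 := (owner_eq_zero I a).mp h1
      rw [hf ⟨a, h3⟩] at h2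
      exact absurd ⟨h3, Fin.ext (by omega)⟩ ha.2
    · rfl
    · rfl

theorem hasEnvyFreeExtension_iff (hn : 0 < I.n) : I.HasEnvyFreeExtension ↔
    ∃ f : ℕ → ℕ, (∀ a < I.numOpen, 1 ≤ f a ∧ f a ≤ I.n) ∧
      NoEnvy I.n I.numOpen (givenValue (owner I) (itemValue I) I.m)
        (openValue (owner I) (itemValue I)) f := by
  have key : ∀ (π : I.OpenItem → Fin I.n) (f : ℕ → ℕ),
      (∀ a : I.OpenItem, f (Nat.count (fun a => owner I a = 0) a.1) = π a + 1) →
      (I.EnvyFree π ↔ NoEnvy I.n I.numOpen (givenValue (owner I) (itemValue I) I.m)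
        (openValue (owner I) (itemValue I)) f) := fun π f hf =>
    ⟨fun h i hi j hj => by
      simpa only [value_bundle I π f hf] using h ⟨i, hi⟩ ⟨j, hj⟩,
      fun h i j => by
        simpa only [value_bundle I π f hf] using h i i.2 j j.2⟩
  constructor
  · rintro ⟨π, hπ⟩
    -- The default `0` is a valid agent because `0 < I.n`, which spares showing that each `Nat.nth`
    -- is an open item.
    let P : ℕ → ℕ := fun a => if h : ∃ h : a < I.m, I.given ⟨a, h⟩ = none then
      π ⟨⟨a, h.1⟩, h.2⟩ else 0
    have hP : ∀ a, P a < I.n := fun a => by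
      simp only [P]
      split_ifs
      exacts [Fin.is_lt _, hn]
    refine ⟨fun c => P (Nat.nth (fun a => owner I a = 0) c) + 1, fun c _ => ⟨Nat.le_add_left 1 _, hP _⟩,
      (key π _ fun a => ?_).mp hπ⟩
    rw [Nat.nth_count (p := fun a => owner I a = 0) ((owner_eq_zero I a.1).mpr a.2)]
    simp [P, a.2]
  · rintro ⟨f, hf, hf'⟩
    have hcount : ∀ a : I.OpenItem, Nat.count (fun a => owner I a = 0) a.1 < I.numOpen := by
      intro a
      rw [numOpen_eq]
      have := Nat.count_monotone (fun a => owner I a = 0) (show a.1.1 + 1 ≤ I.m from a.1.2)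
      rw [Nat.count_succ, if_pos ((owner_eq_zero I a.1).mpr a.2)] at this
      omega
    refine ⟨fun a => ⟨f (Nat.count (fun a => owner I a = 0) a.1) - 1, ?_⟩,
      (key _ f fun a => ?_).mpr hf'⟩
    · have := hf _ (hcount a)
      omega
    · have := hf _ (hcount a)
      simp only
      omega

theorem count_special_encode_le
    (he : Nat.count (Envious I.n (givenValue (owner I) (itemValue I) I.m)) I.n ≤ I.numOpen) :
    Nat.count (Special I.n I.numOpen (givenValue (owner I) (itemValue I) I.m)
      (openValue (owner I) (itemValue I))) I.n ≤
        I.numOpen * I.numAgentTypes + I.numOpen := by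
  classical
  let ty : ℕ → Option (Fin I.m → ℕ) := fun i => if h : i < I.n then some (I.val ⟨i, h⟩) else none
  refine (count_special_le ty (fun i hi i' hi' h => ?_) he).trans
    (Nat.add_le_add_right (Nat.mul_le_mul_left _ ?_) _)
  · have h1 : I.val ⟨i, hi⟩ = I.val ⟨i', hi'⟩ := by simpa [ty, hi, hi'] using h
    have h2 : ∀ a, itemValue I i a = itemValue I i' a := fun a => by simp [itemValue, hi, hi', h1]
    exact ⟨fun j _ => by simp [givenValue, h2], fun a _ => by simp [openValue, h2]⟩
  · rw [AllocationInstance.numAgentTypes, 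
      ← card_image_of_injective (univ.image I.val) (Option.some_injective _)]
    refine card_le_card fun b hb => ?_
    obtain ⟨i, hi, rfl⟩ := mem_image.mp hb
    have hi := mem_range.mp hi
    exact mem_image.mpr ⟨I.val ⟨i, hi⟩, mem_image.mpr ⟨_, mem_univ _, rfl⟩, by simp [ty, hi]⟩

/-! ### The whole program and its running time -/

/-- A program for the extension of partial allocations to envy-free allocations. -/
def solve : Prog :=
  .seq (.assign 1 (.read 0 (.const 0))) (.seq (.assign 2 (.read 0 (.const 1)))
    (.ite (.reg 2) (.ite (.reg 1) solveNonempty (.assign 0 (.const 0))) (.assign 0 (.const 1))))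

/-- For `k ≥ 1` and `y ≥ 2` one has `4 * y ≤ y ^ 3` and `(k + 1) ^ 2 ≤ y ^ 4`, so the exponent `7 *
k` is already enough. The case `y = 1` forces `k = 1` and needs the constant `16`; another `4` comes
from `(n + 1) ^ 2 ≤ 4 * n ^ 2`. -/
theorem pow_mul_sq_le {k y n : ℕ} (hy : k ≤ y) (hn : 0 < n) :
    (4 * y) ^ k * ((k + 1) ^ 2 * (n + 1) ^ 2) ≤ 64 * (y ^ (100000 * k) * n ^ 2) := by
  have hn2 : (n + 1) ^ 2 ≤ 4 * n ^ 2 := by nlinarith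
  rcases Nat.eq_zero_or_pos k with rfl | hk
  · simp; omega
  have h1 : (4 * y) ^ k * (k + 1) ^ 2 ≤ 16 * y ^ (100000 * k) := by
    rcases Nat.lt_or_ge 1 y with hy1 | hy1
    · have h2 : (4 * y) ^ k ≤ y ^ (3 * k) := by
        rw [pow_mul]
        exact Nat.pow_le_pow_left (by nlinarith [Nat.mul_le_mul hy1 hy1]) _
      have h3 : (k + 1) ^ 2 ≤ y ^ (4 * k) := by
        calc (k + 1) ^ 2 ≤ (y * y) ^ 2 := Nat.pow_le_pow_left (by nlinarith) _
          _ = y ^ 4 := by ring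
          _ ≤ y ^ (4 * k) := Nat.pow_le_pow_right (by omega) (by omega)
      calc _ ≤ y ^ (3 * k) * y ^ (4 * k) := Nat.mul_le_mul h2 h3
        _ = y ^ (7 * k) := by rw [← pow_add]; congr 1; ring
        _ ≤ y ^ (100000 * k) := Nat.pow_le_pow_right (by omega) (by omega)
        _ ≤ _ := by omega
    · obtain rfl : k = 1 := by omega
      obtain rfl : y = 1 := by omega
      simp
  calc _ = (4 * y) ^ k * (k + 1) ^ 2 * (n + 1) ^ 2 := by ring
    _ ≤ 16 * y ^ (100000 * k) * (4 * n ^ 2) := Nat.mul_le_mul h1 hn2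
    _ = _ := by ring

/-- Without items the input has only two numbers, and `n` may be exponential in its binary size. The
answer is then immediate, and the term `n ^ 2` has to be dropped for the bound in terms of the
binary size. -/
theorem decidesWithin_solve (I : AllocationInstance) :
    DecidesWithin solve I.encode I.HasEnvyFreeExtension
      (100000 * ((I.numOpen * I.numAgentTypes) ^ (100000 * I.numOpen) *
        (if I.m = 0 then 0 else I.n) ^ 2 + I.encode.length)) := by
  have hnt : I.n ≠ 0 → 1 ≤ I.numAgentTypes := fun hn =>
    card_pos.mpr ⟨_, mem_image_of_mem I.val (mem_univ ⟨0, Nat.pos_of_ne_zero hn⟩)⟩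
  have hlen := length_encode I
  set s := State.init I.encode with hs
  suffices h : Runs solve s (100000 * ((I.numOpen * I.numAgentTypes) ^ (100000 * I.numOpen) *
        (if I.m = 0 then 0 else I.n) ^ 2 + I.encode.length)) fun s' =>
          Flag (s'.reg 0) I.HasEnvyFreeExtension from h
  have hn0 : s.arr 0 0 = I.n := by simp [s, State.init, AllocationInstance.encode]
  have hm0 : s.arr 0 1 = I.m := by simp [s, State.init, AllocationInstance.encode]
  refine Runs.mono (Runs.seq (Runs.assign (Runs.seq (Runs.assign ?_))))
    (T := 3 + (3 + (100000 * ((I.numOpen * I.numAgentTypes) ^ (100000 * I.numOpen) *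
        (if I.m = 0 then 0 else I.n) ^ 2 + I.encode.length) - 6))) (by omega)
  set s₂ := (s.setReg 1 _).setReg 2 _ with hs₂
  have h1 : s₂.reg 1 = I.n := by simp [s₂, Expr.eval, hn0]
  have h2 : s₂.reg 2 = I.m := by simp [s₂, Expr.eval, hm0]
  by_cases hm : I.m = 0
  · refine (Runs.ite (T₁ := 0) (T₂ := 2) (fun h => absurd hm (by simpa [Expr.eval, h2] using h))
      (fun _ => Runs.assign ⟨fun _ => by simp [Expr.eval], fun h => ?_⟩)).mono
      (by simp only [Expr.cost]; omega)
    refine absurd ⟨fun a => absurd a.1.2 (by omega), fun i j => ?_⟩ h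
    have : IsEmpty (Fin I.m) := by rw [hm]; infer_instance
    simp [AllocationInstance.value, Finset.eq_empty_of_isEmpty]
  rw [if_neg hm]
  by_cases hn : I.n = 0
  · refine (Runs.ite (T₁ := 4) (T₂ := 2) (fun _ => (Runs.ite (T₁ := 0) (T₂ := 2)
      (fun h => absurd hn (by simpa [Expr.eval, h1] using h))
      (fun _ => Runs.assign ⟨fun h => ?_, fun _ => by simp [Expr.eval]⟩)).mono
      (by simp [Expr.cost])) (fun h => absurd (by simpa [Expr.eval, h2] using h) hm)).mono
      (by simp only [Expr.cost]; omega)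
    -- With items but no agents every item is open, and nobody can receive it.
    obtain ⟨π, -⟩ := h
    have hlt : 0 < I.m := Nat.pos_of_ne_zero hm
    have hnone : I.given ⟨0, hlt⟩ = none := by
      cases h : I.given ⟨0, hlt⟩ with
      | none => rfl
      | some j => exact absurd j.2 (by omega)
    exact absurd (π ⟨_, hnone⟩).2 (by omega)
  have hn' := Nat.pos_of_ne_zero hn
  have hnt' := hnt hn
  set y := I.numOpen * I.numAgentTypes with hy
  have hky : I.numOpen ≤ y := Nat.le_mul_of_pos_right _ hnt'
  have hrun := runs_solveNonempty (input_encode I (s := s₂) rfl h1 h2) hn' (numOpen_eq I)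
    (fun x => by simp [s₂, s, State.init]) (fun x => by simp [s₂, s, State.init]) rfl rfl
    -- At most `k * n_t + k` special agents give the base `S + 2 * k ≤ k * n_t + 3 * k ≤ 4 * y`, as
    -- `n_t ≥ 1`.
    (B := (4 * y) ^ I.numOpen) (by
      rcases Nat.eq_zero_or_pos I.numOpen with h | h
      · simp [h]
      · exact Nat.pow_pos (by omega))
    (fun he => Nat.pow_le_pow_left (by
      have := count_special_encode_le I he
      omega) _)
  refine (Runs.ite (T₂ := 2) (fun _ => Runs.ite (T₂ := 2) (fun _ => hrun.weaken le_rfl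
    fun s' _ h => h.congr (hasEnvyFreeExtension_iff I hn').symm)
      (fun h => absurd (by simpa [Expr.eval, h1] using h) hn))
      (fun h => absurd (by simpa [Expr.eval, h2] using h) hm)).mono ?_
  have e1 := pow_mul_sq_le hky hn'
  have e2 : (I.n + 1) * (I.m + 1) = I.n * I.m + I.n + I.m + 1 := by ring
  have e3 : I.n ≤ I.n * I.m := Nat.le_mul_of_pos_right _ (Nat.pos_of_ne_zero hm)
  simp only [Expr.cost]
  omega

end EnvySearch

theorem mainTheorem2 :
    RAM.FixedParameterTractable AllocationInstance.encode
      (fun I => I.numOpen + I.numAgentTypes) AllocationInstance.HasEnvyFreeExtension ∧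
    ∃ (p : RAM.Prog) (C : ℕ), ∀ I : AllocationInstance,
      RAM.DecidesWithin p I.encode I.HasEnvyFreeExtension
        (C * ((I.numOpen * I.numAgentTypes) ^ (C * I.numOpen) * I.n ^ 2 + I.encode.length)) := by
  refine ⟨⟨EnvySearch.solve, _, 2, RAM.computable_fpt_bound 100000, fun I => ?_⟩,
    EnvySearch.solve, 100000, fun I => ?_⟩
  · obtain ⟨t, s', he, ht, h⟩ := EnvySearch.decidesWithin_solve I
    refine ⟨t, s', he, ht.trans ?_, h⟩
    have hlen := EnvySearch.length_encode I
    have hb := RAM.length_le_bitSize I.encode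
    set b := RAM.bitSize I.encode
    set κ := I.numOpen + I.numAgentTypes with hκ
    -- As soon as there is an item, the valuations alone contribute `n * m ≥ n` entries.
    have hn : (if I.m = 0 then 0 else I.n) ≤ b := by
      split_ifs with hm
      · exact Nat.zero_le _
      · have := Nat.le_mul_of_pos_right I.n (Nat.pos_of_ne_zero hm)
        omega
    have hpow : (I.numOpen * I.numAgentTypes) ^ (100000 * I.numOpen) ≤
        (κ * κ + 1) ^ (100000 * κ) := by
      calc _ ≤ (κ * κ + 1) ^ (100000 * I.numOpen) := Nat.pow_le_pow_left
            ((Nat.mul_le_mul (Nat.le_add_right _ _) (Nat.le_add_left _ _)).trans (Nat.le_succ _)) _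
        _ ≤ _ := Nat.pow_le_pow_right (by omega) (by omega)
    have hpos : 1 ≤ (κ * κ + 1) ^ (100000 * κ) := Nat.one_le_pow _ _ (by omega)
    have hb2 : I.encode.length ≤ (κ * κ + 1) ^ (100000 * κ) * b ^ 2 := by
      refine hb.trans ?_
      nlinarith [Nat.mul_le_mul hpos (le_refl (b ^ 2)), sq_nonneg b]
    calc _ ≤ 100000 * ((κ * κ + 1) ^ (100000 * κ) * b ^ 2 +
          (κ * κ + 1) ^ (100000 * κ) * b ^ 2) :=
          Nat.mul_le_mul_left _ (Nat.add_le_add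
            (Nat.mul_le_mul hpow (Nat.pow_le_pow_left hn 2)) hb2)
      _ = _ := by ring
  · obtain ⟨t, s', he, ht, h⟩ := EnvySearch.decidesWithin_solve I
    refine ⟨t, s', he, ht.trans (Nat.mul_le_mul_left _ (Nat.add_le_add_right
      (Nat.mul_le_mul_left _ (Nat.pow_le_pow_left ?_ 2)) _)), h⟩
    split_ifs
    exacts [Nat.zero_le _, le_rfl]
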